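/- Setting (mean-field Blume–Capel model). Let $\rho=\frac13(\delta_{-1}+\delta_0+\delta_1)$ and, for $\beta>0$, let $\rho_\beta(d\omega)=e^{-\beta\omega^2}\rho(d\omega)/\int e^{-\beta s^2}\rho(ds)$ and $$c_\beta(t)=\log\int e^{t\omega}\rho_\beta(d\omega)=\log\frac{1+e^{-\beta}(e^t+e^{-t})}{1+2e^{-\beta}},\qquad G_{\beta,K}(x)=\beta Kx^2-c_\beta(2\beta Kx).$$ For $x\in[-1,1]$ let $J_\beta(x)=\sup_{t\in\mathbb R}\{tx-c_\beta(t)\}$, $I_{\beta,K}(x)=J_\beta(x)-\beta Kx^2-\inf_{y\in[-1,1]}\{J_\beta(y)-\beta Ky^2\}$, and let $\mathcal M_{\beta,K}=\{x\in[-1,1]: I_{\beta,K}(x)=0\}$ be the set of equilibrium values of the magnetization. The phase-coexistence region is the set of $(\beta,K)$ with $\beta,K>0$ for which $\mathcal M_{\beta,K}$ has more than one element; there $m(\beta,K)$ denotes the unique positive element of $\mathcal M_{\beta,K}$. Put $\beta_c=\log 4$ and $K(\beta)=(e^\beta+2)/(4\beta)$. For $\beta>\beta_c$ let $K_1(\beta)$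 be the first-order transition value, i.e. the infimum of the $K>0$ such that $(\beta,K)$ lies in the phase-coexistence region, and put $K_1(\beta_c)=K(\beta_c)$; write $K_1',K_1'',K_1'''$ at $\beta_c$ for right-hand derivatives. Let $$\ell_c=-\frac1{4\beta_c}-\frac2{\beta_c^2}+\frac3{\beta_c^3},\qquad \bar x(\ell)=\frac{\sqrt{10}}3\left(1+\left(1-\frac{3\beta_c}5\,(K''(\beta_c)-\ell)\right)^{1/2}\right)^{1/2}\quad(\ell\ge\ell_c).$$ Consider the statements - Conjecture 1: $K_1'(\beta_c)$ exists and equals $K'(\beta_c)$. - Conjecture 2: $K_1''(\beta_c)$ exists and $K_1''(\beta_c)=\ell_c<0<K''(\beta_c)$. - Conjecture 3: $K_1'''(\beta_c)$ exists and $K_1'''(\beta_c)>0$. **Theorem.** Let $\alpha>0$, $\ell,\tilde\ell\in\mathbb R$, and define $$\beta_n=\beta_c+\frac1{n^{\alpha}},\qquad K_n=K(\beta_c)+\frac{K'(\beta_c)}{n^{\alpha}}+\frac{\ell}{2n^{2\alpha}}+\frac{\tilde\ell}{6n^{3\alpha}}.$$ Then $(\beta_n,K_n)\to(\beta_c,K(\beta_c))$,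 and the following hold. (a) With $u=1-3\alpha$ and $\gamma=\alpha/2$, as $n\to\infty$, $$n^{1-u}G_{\beta_n,K_n}(x/n^\gamma)\to g_\ell(x)=\tfrac12\beta_c(K''(\beta_c)-\ell)x^2-\tfrac34x^4+\tfrac9{40}x^6$$ uniformly for $x$ in compact subsets of $\mathbb R$. (b) $\ell_c=K''(\beta_c)-\frac5{4\beta_c}=\frac{-\beta_c^2-8\beta_c+12}{4\beta_c^3}$, and $g_\ell$ has nonzero global minimum points if and only if $\ell\ge\ell_c$. (i) If $\ell>\ell_c$, then $\bar x(\ell)>0$ and the global minimum points of $g_\ell$ are exactly $\pm\bar x(\ell)$. (ii) If $\ell=\ell_c$, they are exactly $0$ and $\pm\bar x(\ell_c)$, where $\bar x(\ell_c)=\sqrt{5/3}$. (c) Assume one of the following: - (i) $\ell>K''(\beta_c)$; - (ii) $\ell=K''(\beta_c)$ and $\tilde\ell>K'''(\beta_c)$; - (iii) $\ell_c<\ell<K''(\beta_c)$, and Conjectures 1 and 2 hold; - (iv) $\ell=\ell_c$, Conjectures 1, 2 and 3 hold, and $\tilde\ell>K_1'''(\beta_c)$. Then for all sufficiently large $n$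 the point $(\beta_n,K_n)$ lies in the phase-coexistence region and $\mathcal M_{\beta_n,K_n}=\{\pm m(\beta_n,K_n)\}$ with $m(\beta_n,K_n)>0$. Moreover $m(\beta_n,K_n)\to0$ and $$m(\beta_n,K_n)\sim\bar x(\ell)/n^{\alpha/2}=\bar x(\ell)(\beta_n-\beta_c)^{1/2},\quad\text{i.e.}\quad \lim_{n\to\infty}n^{\alpha/2}m(\beta_n,K_n)=\bar x(\ell).$$ -/

import Mathlib

open Set Filter Topology MeasureTheory ProbabilityTheory

noncomputable section

namespace BlumeCapel

/-- The single-spin measure `ρ = (δ₋₁ + δ₀ + δ₁) / 3`. -/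
def spinMeasure : Measure ℝ :=
  (3 : ENNReal)⁻¹ • (Measure.dirac (-1) + Measure.dirac 0 + Measure.dirac 1)

/-- The measure `ρ_β(dω) = exp(-β ω²) ρ(dω) / Z(β)`. -/
def spinMeasureBeta (β : ℝ) : Measure ℝ :=
  spinMeasure.tilted (fun ω => -β * ω ^ 2)

/-- The cumulant generating function `c_β(t) = log ∫ exp(t ω) ρ_β(dω)`. -/
def cumulant (β t : ℝ) : ℝ := cgf (fun ω : ℝ => ω) (spinMeasureBeta β) t

/-- The explicit form of `c_β`. -/
theorem cumulant_eq (β t : ℝ) :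
    cumulant β t =
      Real.log ((1 + Real.exp (-β) * (Real.exp t + Real.exp (-t))) / (1 + 2 * Real.exp (-β))) := by
  have hint : ∀ f : ℝ → ℝ, ∫ x, f x ∂spinMeasure = (f (-1) + f 0 + f 1) / 3 := by
    intro f
    have hd : ∀ a : ℝ, Integrable f (Measure.dirac a) := fun a =>
      integrable_dirac (by simp)
    rw [spinMeasure, integral_smul_measure, integral_add_measure
      ((hd _).add_measure (hd _)) (hd _), integral_add_measure (hd _) (hd _)]
    simp only [integral_dirac, ENNReal.toReal_inv, ENNReal.toReal_ofNat, smul_eq_mul]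
    ring
  rw [cumulant, cgf, mgf, spinMeasureBeta, integral_tilted, hint, hint]
  congr 1
  have h := Real.exp_pos (-β)
  simp
  field_simp
  ring

/-- The Legendre-Fenchel transform `J_β(x) = sup_t (t x - c_β(t))`, used for `x ∈ [-1, 1]`,
where the supremum is finite. -/
def legendre (β x : ℝ) : ℝ := ⨆ t : ℝ, (t * x - cumulant β t)

/-- The large deviation rate function `I_{β,K}` of the spin per site, used on `[-1, 1]`. -/
def rateFunction (β K x : ℝ) : ℝ :=
  legendre β x - β * K * x ^ 2
    - ⨅ y : Icc (-1 : ℝ) 1, (legendre β y - β * K * (y : ℝ) ^ 2)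

/-- The set `M_{β,K}` of equilibrium values of the magnetization. -/
def equilibriumSet (β K : ℝ) : Set ℝ :=
  {x | x ∈ Icc (-1 : ℝ) 1 ∧ rateFunction β K x = 0}

/-- The magnetization `m(β,K)`: the positive equilibrium value, which is unique whenever
`(β,K)` lies in the phase-coexistence region. -/
def magnetization (β K : ℝ) : ℝ := sSup {x | x ∈ equilibriumSet β K ∧ 0 < x}

/-- The free-energy functional `G_{β,K}(x) = β K x² - c_β(2 β K x)`. -/
def freeEnergy (β K x : ℝ) : ℝ := β * K * x ^ 2 - cumulant β (2 * β * K * x)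

/-- The points of the positive quadrant for which there is more than one equilibrium value. -/
def phaseCoexistence : Set (ℝ × ℝ) :=
  {p | 0 < p.1 ∧ 0 < p.2 ∧ (equilibriumSet p.1 p.2).Nontrivial}

/-- The critical inverse temperature `β_c = log 4`. -/
def betaC : ℝ := Real.log 4

/-- `K(β) = (e^β + 2) / (4 β)`: the second-order curve for `0 < β < β_c` and
the spinodal curve for `β ≥ β_c`. -/
def curveK (β : ℝ) : ℝ := (Real.exp β + 2) / (4 * β)

/-- The first-order curve `K₁(β)`, `β > β_c`: the value of `K` at which the system passes from the
single phase `M_{β,K} = {0}` to phase coexistence; extended by `K₁(β_c) = K(β_c)`. -/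
def curveK1 (β : ℝ) : ℝ :=
  if β = betaC then curveK betaC else sInf {K : ℝ | (β, K) ∈ phaseCoexistence}

/-- The critical value `ℓ_c` of the curvature parameter. -/
def ellC : ℝ := -1 / (4 * betaC) - 2 / betaC ^ 2 + 3 / betaC ^ 3

/-- The right-hand derivative of order `k` of `f` at `a` exists and equals `d`: the lower-order
derivatives of `f`, as a function on `[a, ∞)`, exist on a right neighbourhood of `a`, and the one
of order `k - 1` has right-hand derivative `d` at `a`. -/
def HasRightDeriv (f : ℝ → ℝ) (a : ℝ) : ℕ → ℝ → Prop
  | 0, d => f a = d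
  | k + 1, d =>
      (∀ i < k, ∀ᶠ x in 𝓝[≥] a,
        DifferentiableWithinAt ℝ (iteratedDerivWithin i f (Ici a)) (Ici a) x) ∧
      HasDerivWithinAt (iteratedDerivWithin k f (Ici a)) d (Ici a) a

/-- `K₁'(β_c)` exists and equals `K'(β_c)`. -/
def Conjecture1 : Prop := HasRightDeriv curveK1 betaC 1 (deriv curveK betaC)

/-- `K₁''(β_c)` exists and `K₁''(β_c) = ℓ_c < 0 < K''(β_c)`. -/
def Conjecture2 : Prop :=
  HasRightDeriv curveK1 betaC 2 ellC ∧ ellC < 0 ∧ 0 < iteratedDeriv 2 curveK betaC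

/-- `K₁'''(β_c)` exists and is positive. -/
def Conjecture3 : Prop := ∃ d : ℝ, 0 < d ∧ HasRightDeriv curveK1 betaC 3 d

/-- `β_n = β_c + 1 / n^α`. -/
def betaSeq (α : ℝ) (n : ℕ) : ℝ := betaC + 1 / (n : ℝ) ^ α

/-- `K_n = K(β_c) + K'(β_c) / n^α + ℓ / (2 n^{2α}) + ℓ' / (6 n^{3α})`. -/
def kSeq (α l l' : ℝ) (n : ℕ) : ℝ :=
  curveK betaC + deriv curveK betaC / (n : ℝ) ^ α
    + l / (2 * (n : ℝ) ^ (2 * α)) + l' / (6 * (n : ℝ) ^ (3 * α))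

/-- The Ginzburg-Landau polynomial `g_ℓ`, with `c₄ = 3/16` and `c₆ = 9/40`. -/
def gl (l x : ℝ) : ℝ :=
  1 / 2 * betaC * (iteratedDeriv 2 curveK betaC - l) * x ^ 2
    - 4 * (3 / 16) * x ^ 4 + 9 / 40 * x ^ 6

/-- The set of global minimum points of a function. -/
def globalMinPoints (g : ℝ → ℝ) : Set ℝ := {x | ∀ y, g x ≤ g y}

/-- The quantity `x̄(ℓ)`. -/
def xBar (l : ℝ) : ℝ :=
  √10 / 3 * √(1 + √(1 - 3 * betaC / 5 * (iteratedDeriv 2 curveK betaC - l)))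

end BlumeCapel

end

namespace BlumeCapel

/-! By convex duality the equilibrium values are the global minimizers of `freeEnergy`
(`equilibriumSet_eq_globalMinPoints`). A Rolle argument shows that at most one of these is positive,
so as soon as the free energy is negative somewhere the equilibrium set is a pair ±m
(`equilibriumSet_of_freeEnergy_neg`).

Put ε = n^{-α/2}, so β_n = β_c + ε². Along the sequence the quadratic, quartic and sextic
coefficients of the free energy have orders ε⁴, ε² and 1. At spin scale ε all three terms therefore
have order ε⁶, and ε⁻⁶ G(εx) converges to `gl` uniformly on compacts
(`tendstoUniformlyOn_scaled_freeEnergy`).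

Convergence on compacts alone does not control minimizers. The missing localization comes from a
polynomial inequality for positive critical points (`quartic_nonpos_of_critical`), which confines
m/ε to a compact interval, bounded away from 0 when ℓ = ℓ_c (`exists_bounds_scaled_isMin`). Every
cluster point of m/ε then minimizes `gl`, and x̄(ℓ) is the only admissible minimizer
(`tendsto_magnetization_div`).

It remains to see that the free energy is eventually negative somewhere. For ℓ > ℓ_c this follows
from g_ℓ(x̄) < 0. For ℓ = ℓ_c the minimum of g_ℓ is 0 and the limit does not decide. There the
conjectured expansion of K₁ places K_n above the first-order curve (`eventually_curveK1_lt_kAt`). -/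

/-! ### The cumulant function: convexity and linear growth -/

theorem cumulant_eq_log_cosh (β t : ℝ) :
    cumulant β t = Real.log ((Real.exp β + 2 * Real.cosh t) / (Real.exp β + 2)) := by
  rw [cumulant_eq, Real.exp_neg β, Real.cosh_eq]
  congr 1
  have := Real.exp_pos β
  field_simp

/-- The mean of the exponential tilt of `ρ_β`, i.e. the derivative of the cumulant function. -/
noncomputable def tiltedMean (β t : ℝ) : ℝ := 2 * Real.sinh t / (Real.exp β + 2 * Real.cosh t)

theorem partition_pos (β t : ℝ) : 0 < Real.exp β + 2 * Real.cosh t := by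
  have := Real.exp_pos β
  have := Real.cosh_pos t
  positivity

theorem cumulant_zero (β : ℝ) : cumulant β 0 = 0 := by
  rw [cumulant_eq_log_cosh, Real.cosh_zero, mul_one, div_self, Real.log_one]
  have := Real.exp_pos β
  positivity

theorem cumulant_neg (β t : ℝ) : cumulant β (-t) = cumulant β t := by
  simp [cumulant_eq_log_cosh]

theorem hasDerivAt_cumulant (β t : ℝ) : HasDerivAt (cumulant β) (tiltedMean β t) t := by
  have h2 : 0 < Real.exp β + 2 := by have := Real.exp_pos β; positivity
  have e : cumulant β = fun t => Real.log ((Real.exp β + 2 * Real.cosh t) / (Real.exp β + 2)) :=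
    funext (cumulant_eq_log_cosh β)
  rw [e]
  have h := partition_pos β t
  have := ((((Real.hasDerivAt_cosh t).const_mul 2).const_add (Real.exp β)).div_const
    (Real.exp β + 2)).log (by positivity)
  convert this using 1
  rw [tiltedMean]
  field_simp

theorem abs_tiltedMean_le_one (β t : ℝ) : |tiltedMean β t| ≤ 1 := by
  have h := partition_pos β t
  have := Real.exp_pos β
  rw [tiltedMean, abs_div, abs_of_pos h, div_le_one h, abs_le, Real.sinh_eq, Real.cosh_eq]
  have := Real.exp_pos t
  have := Real.exp_pos (-t)
  constructor <;> linarith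

/-- The tangent-line inequality for the convex function `c_β`. -/
theorem cumulant_tangent_le (β t₀ t : ℝ) :
    cumulant β t₀ + tiltedMean β t₀ * (t - t₀) ≤ cumulant β t := by
  have h2 : 0 < Real.exp β + 2 := by have := Real.exp_pos β; positivity
  have h0 := partition_pos β t₀
  have h := partition_pos β t
  rw [cumulant_eq_log_cosh, cumulant_eq_log_cosh, Real.log_div h0.ne' h2.ne',
    Real.log_div h.ne' h2.ne']
  set m := tiltedMean β t₀ with hm
  set θ := t - t₀ with hθ
  suffices Real.log (Real.exp β + 2 * Real.cosh t₀) + m * θ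
      ≤ Real.log (Real.exp β + 2 * Real.cosh t) by linarith
  rw [← Real.log_exp (m * θ), ← Real.log_mul h0.ne' (Real.exp_pos _).ne']
  apply Real.log_le_log (by positivity)
  have hmm : m * (Real.exp β + 2 * Real.cosh t₀) = 2 * Real.sinh t₀ := by
    rw [hm, tiltedMean]; field_simp
  -- Jensen by hand: factor e^{mθ} out of each of the three Boltzmann weights and apply 1 + u ≤ e^u.
  -- The linear terms cancel because m is the tilted mean.
  have e1 : Real.exp t = Real.exp t₀ * Real.exp (m * θ) * Real.exp ((1 - m) * θ) := by
    rw [← Real.exp_add, ← Real.exp_add]; congr 1; rw [hθ]; ring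
  have e2 : Real.exp (-t) = Real.exp (-t₀) * Real.exp (m * θ) * Real.exp ((-1 - m) * θ) := by
    rw [← Real.exp_add, ← Real.exp_add]; congr 1; rw [hθ]; ring
  have e3 : Real.exp β = Real.exp β * Real.exp (m * θ) * Real.exp ((0 - m) * θ) := by
    rw [← Real.exp_add, ← Real.exp_add]; congr 1; ring
  have i1 := mul_le_mul_of_nonneg_left (Real.add_one_le_exp ((1 - m) * θ))
    (mul_pos (Real.exp_pos t₀) (Real.exp_pos (m * θ))).le
  have i2 := mul_le_mul_of_nonneg_left (Real.add_one_le_exp ((-1 - m) * θ))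
    (mul_pos (Real.exp_pos (-t₀)) (Real.exp_pos (m * θ))).le
  have i3 := mul_le_mul_of_nonneg_left (Real.add_one_le_exp ((0 - m) * θ))
    (mul_pos (Real.exp_pos β) (Real.exp_pos (m * θ))).le
  rw [← e1] at i1
  rw [← e2] at i2
  rw [← e3] at i3
  rw [Real.cosh_eq, Real.sinh_eq] at hmm
  rw [Real.cosh_eq, Real.cosh_eq]
  have key : Real.exp t₀ * Real.exp (m * θ) * ((1 - m) * θ + 1)
      + Real.exp (-t₀) * Real.exp (m * θ) * ((-1 - m) * θ + 1)
      + Real.exp β * Real.exp (m * θ) * ((0 - m) * θ + 1)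
      = (Real.exp β + 2 * ((Real.exp t₀ + Real.exp (-t₀)) / 2)) * Real.exp (m * θ) := by
    linear_combination (-θ * Real.exp (m * θ)) * hmm
  linarith

theorem cumulant_le_abs (β t : ℝ) : cumulant β t ≤ |t| := by
  have h := cumulant_tangent_le β t 0
  rw [cumulant_zero] at h
  have h1 : tiltedMean β t * t ≤ |t| := by
    calc _ ≤ |tiltedMean β t * t| := le_abs_self _
      _ = |tiltedMean β t| * |t| := abs_mul _ _
      _ ≤ 1 * |t| := by gcongr; exact abs_tiltedMean_le_one β t
      _ = |t| := one_mul _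
  linarith

theorem abs_sub_log_le_cumulant (β t : ℝ) : |t| - Real.log (Real.exp β + 2) ≤ cumulant β t := by
  have h2 : 0 < Real.exp β + 2 := by have := Real.exp_pos β; positivity
  rw [cumulant_eq_log_cosh, Real.log_div (partition_pos β t).ne' h2.ne']
  suffices |t| ≤ Real.log (Real.exp β + 2 * Real.cosh t) by linarith
  rw [Real.le_log_iff_exp_le (partition_pos β t), ← Real.cosh_abs t, Real.cosh_eq]
  have := Real.exp_pos β
  have := Real.exp_pos (-|t|)
  linarith

/-! ### Duality between the rate function and the free energy -/

theorem bddAbove_range_legendre {β x : ℝ} (hx : x ∈ Icc (-1 : ℝ) 1) :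
    BddAbove (range fun t : ℝ => t * x - cumulant β t) := by
  refine ⟨Real.log (Real.exp β + 2), ?_⟩
  rintro _ ⟨t, rfl⟩
  have h1 : t * x ≤ |t| := by
    calc _ ≤ |t * x| := le_abs_self _
      _ = |t| * |x| := abs_mul _ _
      _ ≤ |t| * 1 := by gcongr; exact abs_le.2 hx
      _ = |t| := mul_one _
  have := abs_sub_log_le_cumulant β t
  dsimp only
  linarith

theorem le_legendre {β x : ℝ} (hx : x ∈ Icc (-1 : ℝ) 1) (t : ℝ) :
    t * x - cumulant β t ≤ legendre β x :=
  le_ciSup (bddAbove_range_legendre hx) t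

theorem legendre_tiltedMean (β t : ℝ) :
    legendre β (tiltedMean β t) = t * tiltedMean β t - cumulant β t := by
  apply le_antisymm
  · apply ciSup_le
    intro s
    have := cumulant_tangent_le β t s
    linarith
  · exact le_legendre (abs_le.1 (abs_tiltedMean_le_one β t)) t

/-- Take t = 2βKx in the supremum defining J_β. At critical points of the free energy this t attains
the supremum, so the two functionals agree there. -/
theorem freeEnergy_le {β K x : ℝ} (hx : x ∈ Icc (-1 : ℝ) 1) :
    freeEnergy β K x ≤ legendre β x - β * K * x ^ 2 := by
  have := le_legendre (β := β) hx (2 * β * K * x)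
  rw [freeEnergy]
  linarith

theorem freeEnergy_zero (β K : ℝ) : freeEnergy β K 0 = 0 := by
  simp [freeEnergy, cumulant_zero]

theorem freeEnergy_neg (β K x : ℝ) : freeEnergy β K (-x) = freeEnergy β K x := by
  simp [freeEnergy, cumulant_neg]

theorem hasDerivAt_freeEnergy (β K x : ℝ) :
    HasDerivAt (freeEnergy β K) (2 * β * K * (x - tiltedMean β (2 * β * K * x))) x := by
  have h1 := ((hasDerivAt_id x).pow 2).const_mul (β * K)
  have h2 := (hasDerivAt_cumulant β (2 * β * K * x)).comp x
    ((hasDerivAt_id x).const_mul (2 * β * K))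
  refine (h1.sub h2).congr_deriv ?_
  simp only [id, mul_one]
  ring

theorem eq_tiltedMean_of_isMin {β K x : ℝ} (hβ : 0 < β) (hK : 0 < K)
    (hx : x ∈ globalMinPoints (freeEnergy β K)) : x = tiltedMean β (2 * β * K * x) := by
  have hloc : IsLocalMin (freeEnergy β K) x := Filter.Eventually.of_forall hx
  have := hloc.hasDerivAt_eq_zero (hasDerivAt_freeEnergy β K x)
  have h2 : 2 * β * K ≠ 0 := by positivity
  have := (mul_eq_zero.1 this).resolve_left h2
  linarith

theorem exists_freeEnergy_isMin {β K : ℝ} (hβ : 0 < β) (hK : 0 < K) :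
    (globalMinPoints (freeEnergy β K)).Nonempty := by
  have hc : Continuous (freeEnergy β K) :=
    continuous_iff_continuousAt.2 fun x => (hasDerivAt_freeEnergy β K x).continuousAt
  have hb : 0 < β * K := mul_pos hβ hK
  refine hc.exists_forall_le' (x₀ := 0) ?_
  rw [freeEnergy_zero]
  -- Since c_β(t) ≤ |t|, the free energy is at least βK|x|(|x| - 2), hence nonnegative once |x| ≥ 2.
  have : {x : ℝ | ¬ 0 ≤ freeEnergy β K x} ⊆ Icc (-2) 2 := by
    intro x hx
    by_contra hn
    apply hx
    have hx2 : 2 ≤ |x| := by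
      by_contra h
      exact hn (abs_le.1 (not_le.1 h).le)
    have h1 := cumulant_le_abs β (2 * β * K * x)
    rw [abs_mul, abs_of_pos (by positivity : 0 < 2 * β * K)] at h1
    have : 0 ≤ β * K * (|x| * (|x| - 2)) :=
      mul_nonneg hb.le (mul_nonneg (abs_nonneg _) (by linarith))
    rw [freeEnergy, ← sq_abs]
    nlinarith
  exact Filter.mem_cocompact.2 ⟨Icc (-2) 2, isCompact_Icc, fun x hx => by
    by_contra h; exact hx (this h)⟩

/-- The equilibrium macrostates are the global minimum points of the free-energy functional. -/
theorem equilibriumSet_eq_globalMinPoints {β K : ℝ} (hβ : 0 < β) (hK : 0 < K) :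
    equilibriumSet β K = globalMinPoints (freeEnergy β K) := by
  have hmin : ∀ x ∈ globalMinPoints (freeEnergy β K), x ∈ Icc (-1 : ℝ) 1 ∧
      legendre β x - β * K * x ^ 2 = freeEnergy β K x := by
    intro x hx
    have h := eq_tiltedMean_of_isMin hβ hK hx
    refine ⟨?_, ?_⟩
    · rw [h]; exact abs_le.1 (abs_tiltedMean_le_one _ _)
    · have h2 := legendre_tiltedMean β (2 * β * K * x)
      rw [← h] at h2
      rw [h2, freeEnergy]
      ring
  obtain ⟨x₀, hx₀⟩ := exists_freeEnergy_isMin hβ hK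
  have hinf : ⨅ y : Icc (-1 : ℝ) 1, (legendre β y - β * K * (y : ℝ) ^ 2)
      = freeEnergy β K x₀ := by
    have : Nonempty (Icc (-1 : ℝ) 1) := ⟨⟨x₀, (hmin x₀ hx₀).1⟩⟩
    have hlow : ∀ y : Icc (-1 : ℝ) 1,
        freeEnergy β K x₀ ≤ legendre β y - β * K * (y : ℝ) ^ 2 := fun y =>
      (hx₀ y).trans (freeEnergy_le y.2)
    apply le_antisymm
    · rw [← (hmin x₀ hx₀).2]
      exact ciInf_le ⟨freeEnergy β K x₀, by rintro _ ⟨y, rfl⟩; exact hlow y⟩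
        (⟨x₀, (hmin x₀ hx₀).1⟩ : Icc (-1 : ℝ) 1)
    · exact le_ciInf hlow
  ext x
  simp only [equilibriumSet, rateFunction, mem_ofPred_eq, hinf]
  constructor
  · rintro ⟨hx, h⟩ y
    have := freeEnergy_le (β := β) (K := K) hx
    have := hx₀ y
    linarith
  · intro hx
    obtain ⟨h1, h2⟩ := hmin x hx
    refine ⟨h1, ?_⟩
    have := le_antisymm (hx x₀) (hx₀ x)
    linarith

/-! ### Uniqueness of the positive minimizer -/

theorem exists_deriv_zero_between {f f' : ℝ → ℝ} (hf : ∀ x, HasDerivAt f (f' x) x) {a b : ℝ}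
    (hab : a < b) (h : f a = f b) : ∃ c, a < c ∧ c < b ∧ f' c = 0 := by
  obtain ⟨c, hc, h0⟩ := exists_hasDerivAt_eq_zero hab
    (fun x _ => (hf x).continuousAt.continuousWithinAt) h (fun x _ => hf x)
  exact ⟨c, hc.1, hc.2, h0⟩

/-- With t = 0 there would be four zeros of st(A + 2cosh t) - 2sinh t. Rolle twice gives two
positive zeros of the second derivative, which is 2cosh t · (st + (2s - 1)tanh t). The bracket also
vanishes at 0, so Rolle once more gives two distinct positive zeros of s + (2s - 1)/cosh² t. As cosh
is strictly increasing there, 2s = 1, and then s = 0. -/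
theorem not_exists_three_pos_zeros {A s t₁ t₂ t₃ : ℝ} (hs : 0 < s) (h1 : 0 < t₁) (h12 : t₁ < t₂)
    (h23 : t₂ < t₃) (e1 : s * t₁ * (A + 2 * Real.cosh t₁) = 2 * Real.sinh t₁)
    (e2 : s * t₂ * (A + 2 * Real.cosh t₂) = 2 * Real.sinh t₂)
    (e3 : s * t₃ * (A + 2 * Real.cosh t₃) = 2 * Real.sinh t₃) : False := by
  have d0 : ∀ t, HasDerivAt (fun t => s * t * (A + 2 * Real.cosh t) - 2 * Real.sinh t)
      (s * (A + 2 * Real.cosh t) + s * t * (2 * Real.sinh t) - 2 * Real.cosh t) t := by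
    intro t
    have := (((hasDerivAt_id t).const_mul s).mul
      (((Real.hasDerivAt_cosh t).const_mul 2).const_add A)).sub
      ((Real.hasDerivAt_sinh t).const_mul 2)
    refine this.congr_deriv ?_
    simp only [id, mul_one]
  have d1 : ∀ t, HasDerivAt
      (fun t => s * (A + 2 * Real.cosh t) + s * t * (2 * Real.sinh t) - 2 * Real.cosh t)
      (Real.cosh t * (2 * (s * t + (2 * s - 1) * (Real.sinh t / Real.cosh t)))) t := by
    intro t
    have := (((((Real.hasDerivAt_cosh t).const_mul 2).const_add A).const_mul s).add
      (((hasDerivAt_id t).const_mul s).mul ((Real.hasDerivAt_sinh t).const_mul 2))).sub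
      ((Real.hasDerivAt_cosh t).const_mul 2)
    refine this.congr_deriv ?_
    have := Real.cosh_pos t
    simp only [id, mul_one]
    field_simp
    ring
  have d2 : ∀ t, HasDerivAt
      (fun t => s * t + (2 * s - 1) * (Real.sinh t / Real.cosh t))
      (s + (2 * s - 1) * (1 / Real.cosh t ^ 2)) t := by
    intro t
    have hc := Real.cosh_pos t
    have := ((hasDerivAt_id t).const_mul s).add
      (((Real.hasDerivAt_sinh t).div (Real.hasDerivAt_cosh t) hc.ne').const_mul (2 * s - 1))
    refine this.congr_deriv ?_
    have := Real.cosh_sq t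
    simp only [mul_one]
    rw [← sq, ← sq, this]
    ring
  have z : ∀ t, s * t * (A + 2 * Real.cosh t) = 2 * Real.sinh t →
      s * t * (A + 2 * Real.cosh t) - 2 * Real.sinh t = 0 := fun t h => sub_eq_zero.2 h
  obtain ⟨u1, a1, b1, c1⟩ := exists_deriv_zero_between d0 h1 (by rw [z t₁ e1]; simp)
  obtain ⟨u2, a2, b2, c2⟩ := exists_deriv_zero_between d0 h12 (by rw [z t₁ e1, z t₂ e2])
  obtain ⟨u3, a3, b3, c3⟩ := exists_deriv_zero_between d0 h23 (by rw [z t₂ e2, z t₃ e3])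
  obtain ⟨v1, p1, q1, r1⟩ := exists_deriv_zero_between d1 (b1.trans a2) (by rw [c1, c2])
  obtain ⟨v2, p2, q2, r2⟩ := exists_deriv_zero_between d1 (b2.trans a3) (by rw [c2, c3])
  have r1' := (mul_eq_zero.1 r1).resolve_left (Real.cosh_pos _).ne'
  have r2' := (mul_eq_zero.1 r2).resolve_left (Real.cosh_pos _).ne'
  obtain ⟨w1, l1, m1, n1⟩ := exists_deriv_zero_between d2 (a1.trans p1) (by simp; linarith)
  obtain ⟨w2, l2, m2, n2⟩ := exists_deriv_zero_between d2 (q1.trans p2) (by linarith)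
  have hw : Real.cosh w1 < Real.cosh w2 := by
    rw [Real.cosh_lt_cosh, abs_of_pos l1, abs_of_pos (by linarith)]
    linarith
  have hc := Real.cosh_pos w1
  have hlt : 1 / Real.cosh w2 ^ 2 < 1 / Real.cosh w1 ^ 2 := by
    apply one_div_lt_one_div_of_lt (by positivity)
    gcongr
  have h0 : (2 * s - 1) * (1 / Real.cosh w1 ^ 2 - 1 / Real.cosh w2 ^ 2) = 0 := by linarith
  rcases mul_eq_zero.1 h0 with h | h
  · rw [h] at n1; linarith
  · linarith

theorem critical_equation {β K x : ℝ} (hβ : 0 < β) (hK : 0 < K)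
    (h : x = tiltedMean β (2 * β * K * x)) :
    1 / (2 * β * K) * (2 * β * K * x) * (Real.exp β + 2 * Real.cosh (2 * β * K * x))
      = 2 * Real.sinh (2 * β * K * x) := by
  have hp := partition_pos β (2 * β * K * x)
  rw [tiltedMean, eq_div_iff hp.ne'] at h
  rw [← h]
  field_simp

/-- Two global minimizers lie at the same level, so Rolle puts a third critical point between them.
The variable t = 2βKx turns these into three positive zeros. -/
theorem pos_isMin_unique {β K x y : ℝ} (hβ : 0 < β) (hK : 0 < K) (hx0 : 0 < x)
    (hxy : x < y) (hx : x ∈ globalMinPoints (freeEnergy β K))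
    (hy : y ∈ globalMinPoints (freeEnergy β K)) : False := by
  have hb : 0 < 2 * β * K := by positivity
  obtain ⟨z, h1, h2, h3⟩ := exists_deriv_zero_between (hasDerivAt_freeEnergy β K) hxy
    (le_antisymm (hx y) (hy x))
  have hz : z = tiltedMean β (2 * β * K * z) := by
    have := (mul_eq_zero.1 h3).resolve_left hb.ne'
    linarith
  exact not_exists_three_pos_zeros (one_div_pos.2 hb) (mul_pos hb hx0)
    (mul_lt_mul_of_pos_left h1 hb) (mul_lt_mul_of_pos_left h2 hb)
    (critical_equation hβ hK (eq_tiltedMean_of_isMin hβ hK hx))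
    (critical_equation hβ hK hz)
    (critical_equation hβ hK (eq_tiltedMean_of_isMin hβ hK hy))

/-- If the free energy takes a negative value, there are exactly two equilibrium values. -/
theorem equilibriumSet_of_freeEnergy_neg {β K x : ℝ} (hβ : 0 < β) (hK : 0 < K)
    (hx : freeEnergy β K x < 0) :
    0 < magnetization β K ∧ magnetization β K ∈ globalMinPoints (freeEnergy β K) ∧
      equilibriumSet β K = {magnetization β K, -magnetization β K} := by
  obtain ⟨y, hy⟩ := exists_freeEnergy_isMin hβ hK
  have hne : ∀ z ∈ globalMinPoints (freeEnergy β K), z ≠ 0 := by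
    rintro z hz rfl
    have := hz x
    rw [freeEnergy_zero] at this
    linarith
  have hneg : ∀ z ∈ globalMinPoints (freeEnergy β K), -z ∈ globalMinPoints (freeEnergy β K) := by
    intro z hz w
    rw [freeEnergy_neg]
    exact hz w
  obtain ⟨m, hm0, hm⟩ : ∃ m, 0 < m ∧ m ∈ globalMinPoints (freeEnergy β K) := by
    rcases lt_or_gt_of_ne (hne y hy) with h | h
    · exact ⟨-y, by linarith, hneg y hy⟩
    · exact ⟨y, h, hy⟩
  have huniq : ∀ z ∈ globalMinPoints (freeEnergy β K), 0 < z → z = m := by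
    intro z hz hz0
    rcases lt_trichotomy z m with h | h | h
    · exact (pos_isMin_unique hβ hK hz0 h hz hm).elim
    · exact h
    · exact (pos_isMin_unique hβ hK hm0 h hm hz).elim
  have hmag : magnetization β K = m := by
    have : {x | x ∈ equilibriumSet β K ∧ 0 < x} = {m} := by
      ext z
      rw [equilibriumSet_eq_globalMinPoints hβ hK]
      constructor
      · rintro ⟨h1, h2⟩; exact huniq z h1 h2
      · rintro rfl; exact ⟨hm, hm0⟩
    rw [magnetization, this, csSup_singleton]
  rw [hmag]
  refine ⟨hm0, hm, ?_⟩
  rw [equilibriumSet_eq_globalMinPoints hβ hK]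
  ext z
  simp only [mem_insert_iff, mem_singleton_iff]
  constructor
  · intro hz
    rcases lt_or_gt_of_ne (hne z hz) with h | h
    · right
      have := huniq (-z) (hneg z hz) (by linarith)
      linarith
    · left; exact huniq z hz h
  · rintro (rfl | rfl)
    · exact hm
    · exact hneg _ hm

/-- A polynomial bound satisfied by positive critical points of the free energy. -/
theorem quartic_nonpos_of_critical {A s t : ℝ} (hs : 1 / 5 ≤ s) (ht : 0 < t)
    (h : s * t * (A + 2 * Real.cosh t) = 2 * Real.sinh t) :
    (s * (A + 2) / 2 - 1) + (3 * s - 1) / 6 * t ^ 2 + (5 * s - 1) / 120 * t ^ 4 ≤ 0 := by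
  -- The series of st·cosh t - sinh t has coefficients (s(2k+1) - 1)/(2k+1)!. They are nonnegative
  -- for k ≥ 3, so the sum dominates its first three terms; the critical equation makes the sum
  -- equal to -stA/2.
  have hsum := ((Real.hasSum_cosh t).mul_left (s * t)).sub (Real.hasSum_sinh t)
  have hterm : ∀ k : ℕ, s * t * (t ^ (2 * k) / ((2 * k).factorial : ℝ))
      - t ^ (2 * k + 1) / ((2 * k + 1).factorial : ℝ)
      = (s * (2 * k + 1) - 1) * (t ^ (2 * k + 1) / ((2 * k + 1).factorial : ℝ)) := by
    intro k
    have : ((2 * k).factorial : ℝ) ≠ 0 := by positivity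
    have : (2 * (k : ℝ) + 1) ≠ 0 := by positivity
    rw [Nat.factorial_succ]
    push_cast
    field_simp
    ring
  have hle := sum_le_hasSum (Finset.range 3) (fun k hk => by
    have hk3 : 3 ≤ k := by simpa using hk
    have hk' : (3 : ℝ) ≤ k := by exact_mod_cast hk3
    rw [hterm]
    apply mul_nonneg _ (by positivity)
    nlinarith) hsum
  simp only [Finset.sum_range_succ, Finset.sum_range_zero, hterm] at hle
  norm_num [Nat.factorial] at hle
  have : t * ((s * (A + 2) / 2 - 1) + (3 * s - 1) / 6 * t ^ 2 + (5 * s - 1) / 120 * t ^ 4) ≤ 0 := by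
    nlinarith
  by_contra hcon
  have := mul_pos ht (not_le.1 hcon)
  linarith

/-! ### One-sided Taylor expansions -/

/-- The mean value inequality on [a, x], where |f'| ≤ c(x - a)^k, gains one power. -/
theorem isLittleO_of_hasDerivWithinAt_isLittleO {f f' : ℝ → ℝ} {a : ℝ} {k : ℕ}
    (hf : ∀ᶠ x in 𝓝[≥] a, HasDerivWithinAt f (f' x) (Ici a) x) (ha : f a = 0)
    (h : f' =o[𝓝[≥] a] fun x => (x - a) ^ k) : f =o[𝓝[≥] a] fun x => (x - a) ^ (k + 1) := by
  rw [Asymptotics.isLittleO_iff] at h ⊢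
  intro c hc
  obtain ⟨u, hu, hI⟩ := (mem_nhdsGE_iff_exists_Ico_subset).1 ((h hc).and hf)
  filter_upwards [Ico_mem_nhdsGE hu] with x hx
  have hax : 0 ≤ x - a := sub_nonneg.2 hx.1
  have hsub : ∀ z ∈ Icc a x, z ∈ Ico a u := fun z hz => ⟨hz.1, hz.2.trans_lt hx.2⟩
  have := (convex_Icc a x).norm_image_sub_le_of_norm_hasDerivWithin_le (C := c * (x - a) ^ k)
    (f := f) (f' := f')
    (fun z hz => (hI (hsub z hz)).2.mono (fun w hw => hw.1))
    (fun z hz => ((hI (hsub z hz)).1).trans (by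
      have hz0 : 0 ≤ z - a := sub_nonneg.2 hz.1
      rw [Real.norm_eq_abs, abs_of_nonneg (by positivity)]
      gcongr
      exact hz.2)) (left_mem_Icc.2 hx.1) (right_mem_Icc.2 hx.1)
  rw [ha, sub_zero] at this
  refine this.trans_eq ?_
  rw [Real.norm_eq_abs, Real.norm_eq_abs, abs_of_nonneg hax, abs_of_nonneg (by positivity)]
  ring

/-- One-sided Taylor expansion of order two with Peano remainder. -/
theorem taylor_two_isLittleO {f f₁ : ℝ → ℝ} {a d : ℝ}
    (hf : ∀ᶠ x in 𝓝[≥] a, HasDerivWithinAt f (f₁ x) (Ici a) x)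
    (hf₁ : HasDerivWithinAt f₁ d (Ici a) a) :
    (fun x => f x - f a - f₁ a * (x - a) - d / 2 * (x - a) ^ 2)
      =o[𝓝[≥] a] fun x => (x - a) ^ 2 := by
  refine isLittleO_of_hasDerivWithinAt_isLittleO (k := 1)
    (f' := fun x => f₁ x - f₁ a - d * (x - a)) ?_ (by simp) ?_
  · filter_upwards [hf] with x hx
    have hid := (hasDerivWithinAt_id x (Ici a)).sub_const a
    have := ((hx.sub_const (f a)).sub (hid.const_mul (f₁ a))).sub ((hid.pow 2).const_mul (d / 2))
    refine this.congr_deriv ?_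
    simp only [id]
    norm_num
    ring
  · have := hasDerivWithinAt_iff_isLittleO.1 hf₁
    simpa [mul_comm] using this

/-- One-sided Taylor expansion of order three with Peano remainder. -/
theorem taylor_three_isLittleO {f f₁ f₂ : ℝ → ℝ} {a d : ℝ}
    (hf : ∀ᶠ x in 𝓝[≥] a, HasDerivWithinAt f (f₁ x) (Ici a) x)
    (hf₁ : ∀ᶠ x in 𝓝[≥] a, HasDerivWithinAt f₁ (f₂ x) (Ici a) x)
    (hf₂ : HasDerivWithinAt f₂ d (Ici a) a) :
    (fun x => f x - f a - f₁ a * (x - a) - f₂ a / 2 * (x - a) ^ 2 - d / 6 * (x - a) ^ 3)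
      =o[𝓝[≥] a] fun x => (x - a) ^ 3 := by
  refine isLittleO_of_hasDerivWithinAt_isLittleO (k := 2)
    (f' := fun x => f₁ x - f₁ a - f₂ a * (x - a) - d / 2 * (x - a) ^ 2) ?_ (by simp)
    (taylor_two_isLittleO hf₁ hf₂)
  filter_upwards [hf] with x hx
  have hid := (hasDerivWithinAt_id x (Ici a)).sub_const a
  have := (((hx.sub_const (f a)).sub (hid.const_mul (f₁ a))).sub
    ((hid.pow 2).const_mul (f₂ a / 2))).sub ((hid.pow 3).const_mul (d / 6))
  refine this.congr_deriv ?_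
  simp only [id]
  norm_num
  ring

/-! ### Asymptotics of the parameters at the tricritical point -/

theorem exp_betaC : Real.exp betaC = 4 := Real.exp_log (by norm_num)

theorem betaC_pos : 0 < betaC := Real.log_pos (by norm_num)

theorem curveK_betaC : curveK betaC = 3 / (2 * betaC) := by
  have := betaC_pos
  rw [curveK, exp_betaC]
  field_simp
  norm_num

theorem hasDerivAt_curveK {x : ℝ} (hx : x ≠ 0) :
    HasDerivAt curveK (Real.exp x / (4 * x) - (Real.exp x + 2) / (4 * x ^ 2)) x := by
  have := ((Real.hasDerivAt_exp x).add_const 2).div ((hasDerivAt_id x).const_mul 4)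
    (by simpa using hx)
  refine this.congr_deriv ?_
  simp only [id]
  field_simp

theorem hasDerivAt_deriv_curveK {x : ℝ} (hx : x ≠ 0) :
    HasDerivAt (deriv curveK) (Real.exp x / (4 * x) - Real.exp x / (2 * x ^ 2)
      + (Real.exp x + 2) / (2 * x ^ 3)) x := by
  have hev : deriv curveK =ᶠ[𝓝 x]
      fun x => Real.exp x / (4 * x) - (Real.exp x + 2) / (4 * x ^ 2) := by
    filter_upwards [isOpen_ne.mem_nhds hx] with y hy using (hasDerivAt_curveK hy).deriv
  refine HasDerivAt.congr_of_eventuallyEq ?_ hev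
  have h1 := (Real.hasDerivAt_exp x).div ((hasDerivAt_id x).const_mul 4) (by simpa using hx)
  have h2 := ((Real.hasDerivAt_exp x).add_const 2).div
    (((hasDerivAt_id x).pow 2).const_mul 4) (by simpa using hx)
  refine (h1.sub h2).congr_deriv ?_
  simp only [id]
  norm_num
  field_simp
  ring

theorem iteratedDeriv_two_curveK_eq :
    iteratedDeriv 2 curveK betaC = deriv (deriv curveK) betaC := by
  rw [iteratedDeriv_succ, iteratedDeriv_one]

theorem iteratedDeriv_two_curveK : iteratedDeriv 2 curveK betaC
    = 1 / betaC - 2 / betaC ^ 2 + 3 / betaC ^ 3 := by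
  have := betaC_pos
  rw [iteratedDeriv_two_curveK_eq, (hasDerivAt_deriv_curveK betaC_pos.ne').deriv, exp_betaC]
  field_simp
  ring

/-- The interaction strength of the sequence as a function of `δ = β - β_c`. -/
noncomputable def kAt (l l' δ : ℝ) : ℝ :=
  curveK betaC + deriv curveK betaC * δ + l / 2 * δ ^ 2 + l' / 6 * δ ^ 3

/-- Twice the product of inverse temperature and interaction strength, as a function of `δ`. -/
noncomputable def slopeAt (l l' δ : ℝ) : ℝ := 2 * (betaC + δ) * kAt l l' δ

/-- The variance of `ρ_β` at `β = β_c + δ`. -/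
noncomputable def varAt (δ : ℝ) : ℝ := 2 / (Real.exp (betaC + δ) + 2)

theorem varAt_pos (δ : ℝ) : 0 < varAt δ := by
  have := Real.exp_pos (betaC + δ)
  rw [varAt]; positivity

theorem varAt_le_one (δ : ℝ) : varAt δ ≤ 1 := by
  have := Real.exp_pos (betaC + δ)
  rw [varAt, div_le_one (by positivity)]
  linarith

theorem tendsto_kAt (l l' : ℝ) : Tendsto (kAt l l') (𝓝[>] 0) (𝓝 (curveK betaC)) := by
  have : Continuous (kAt l l') := by unfold kAt; fun_prop
  have h := this.tendsto 0
  simp only [kAt] at h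
  simpa using h.mono_left nhdsWithin_le_nhds

theorem tendsto_slopeAt (l l' : ℝ) : Tendsto (slopeAt l l') (𝓝[>] 0) (𝓝 3) := by
  have hb := betaC_pos
  have h1 : Tendsto (fun δ : ℝ => 2 * (betaC + δ)) (𝓝[>] 0) (𝓝 (2 * (betaC + 0))) :=
    ((by fun_prop : Continuous fun δ : ℝ => 2 * (betaC + δ)).tendsto 0).mono_left
      nhdsWithin_le_nhds
  have := h1.mul (tendsto_kAt l l')
  rw [curveK_betaC] at this
  have e : 2 * (betaC + 0) * (3 / (2 * betaC)) = 3 := by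
    rw [add_zero]
    field_simp
  rwa [e] at this

theorem hasDerivAt_varAt : HasDerivAt varAt (-2 / 9) 0 := by
  have h := (((Real.hasDerivAt_exp (betaC + 0)).comp 0
    ((hasDerivAt_id (0 : ℝ)).const_add betaC)).add_const 2).fun_inv (by
      have := Real.exp_pos (betaC + 0)
      simp only [Function.comp]
      positivity)
  have := h.const_mul 2
  refine (this.congr_deriv ?_).congr_of_eventuallyEq (Eventually.of_forall fun δ => ?_)
  · simp [exp_betaC]
    norm_num
  · simp [varAt, div_eq_mul_inv]

theorem varAt_zero : varAt 0 = 1 / 3 := by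
  rw [varAt, add_zero, exp_betaC]; norm_num

theorem tendsto_varAt : Tendsto varAt (𝓝[>] 0) (𝓝 (1 / 3)) := by
  rw [← varAt_zero]
  exact hasDerivAt_varAt.continuousAt.tendsto.mono_left nhdsWithin_le_nhds

theorem tendsto_varAt_slope :
    Tendsto (fun δ => (1 - 3 * varAt δ) / δ) (𝓝[>] 0) (𝓝 (2 / 3)) := by
  have h := hasDerivAt_varAt.tendsto_slope_zero_right.const_mul (-3)
  convert h using 2 with δ
  · rw [zero_add, varAt_zero, smul_eq_mul]
    ring
  · norm_num

theorem tendsto_betaC_add_nhdsGE :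
    Tendsto (fun δ : ℝ => betaC + δ) (𝓝[>] 0) (𝓝[≥] betaC) := by
  refine tendsto_nhdsWithin_iff.2 ⟨?_, ?_⟩
  · have : Tendsto (fun δ : ℝ => betaC + δ) (𝓝 0) (𝓝 (betaC + 0)) :=
      (by fun_prop : Continuous fun δ : ℝ => betaC + δ).tendsto 0
    rw [add_zero] at this
    exact this.mono_left nhdsWithin_le_nhds
  · filter_upwards [self_mem_nhdsWithin] with δ hδ
    have : (0 : ℝ) < δ := hδ
    simp only [mem_Ici]
    linarith

/-- `kAt` matches K to first order at β_c, so the second-order coefficients decide the limit and the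
cubic term vanishes. -/
theorem tendsto_curveK_sub (l l' : ℝ) :
    Tendsto (fun δ => (curveK (betaC + δ) - kAt l l' δ) / δ ^ 2) (𝓝[>] 0)
      (𝓝 ((iteratedDeriv 2 curveK betaC - l) / 2)) := by
  have ht := taylor_two_isLittleO (f := curveK) (f₁ := deriv curveK) (a := betaC)
    (d := iteratedDeriv 2 curveK betaC) (by
      filter_upwards [self_mem_nhdsWithin] with x hx
      have : x ≠ 0 := (betaC_pos.trans_le hx).ne'
      exact (hasDerivAt_curveK this).differentiableAt.hasDerivAt.hasDerivWithinAt) (by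
      rw [iteratedDeriv_two_curveK_eq]
      exact (hasDerivAt_deriv_curveK betaC_pos.ne').differentiableAt.hasDerivAt.hasDerivWithinAt)
  have h2 := (ht.comp_tendsto tendsto_betaC_add_nhdsGE).tendsto_div_nhds_zero
  have h3 : Tendsto (fun δ : ℝ => (iteratedDeriv 2 curveK betaC - l) / 2 - l' / 6 * δ) (𝓝[>] 0)
      (𝓝 ((iteratedDeriv 2 curveK betaC - l) / 2 - l' / 6 * 0)) :=
    ((by fun_prop : Continuous fun δ : ℝ =>
      (iteratedDeriv 2 curveK betaC - l) / 2 - l' / 6 * δ).tendsto 0).mono_left nhdsWithin_le_nhds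
  have h4 := h2.add h3
  rw [mul_zero, sub_zero, zero_add] at h4
  refine h4.congr' ?_
  filter_upwards [self_mem_nhdsWithin] with δ hδ
  have : δ ≠ 0 := ne_of_gt hδ
  simp only [Function.comp, kAt, add_sub_cancel_left]
  field_simp
  ring

/-- Rests on 2β·K(β)·Var(ρ_β) = 1: the curve K(β) is where the quadratic coefficient of the free
energy vanishes. -/
theorem one_sub_varAt_mul_slopeAt {δ : ℝ} (hδ : 0 < δ) (l l' : ℝ) :
    1 - varAt δ * slopeAt l l' δ
      = (curveK (betaC + δ) - kAt l l' δ) * (2 * (betaC + δ) * varAt δ) := by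
  have := Real.exp_pos (betaC + δ)
  have : betaC + δ ≠ 0 := (add_pos betaC_pos hδ).ne'
  rw [varAt, slopeAt, curveK]
  field_simp
  ring

theorem tendsto_one_sub_varAt_mul_slopeAt (l l' : ℝ) :
    Tendsto (fun δ => (1 - varAt δ * slopeAt l l' δ) / δ ^ 2) (𝓝[>] 0)
      (𝓝 ((iteratedDeriv 2 curveK betaC - l) * betaC / 3)) := by
  have h1 : Tendsto (fun δ : ℝ => 2 * (betaC + δ)) (𝓝[>] 0) (𝓝 (2 * (betaC + 0))) :=
    ((by fun_prop : Continuous fun δ : ℝ => 2 * (betaC + δ)).tendsto 0).mono_left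
      nhdsWithin_le_nhds
  have := (tendsto_curveK_sub l l').mul (h1.mul tendsto_varAt)
  have e : (iteratedDeriv 2 curveK betaC - l) / 2 * (2 * (betaC + 0) * (1 / 3))
    = (iteratedDeriv 2 curveK betaC - l) * betaC / 3 := by ring
  rw [e] at this
  refine this.congr' ?_
  filter_upwards [self_mem_nhdsWithin] with δ hδ
  rw [one_sub_varAt_mul_slopeAt hδ]
  ring

/-! ### Sixth-order expansion of log(1 + p(cosh t - 1)) with explicit remainder -/

theorem abs_cosh_sub_le {t : ℝ} (ht : |t| ≤ 1) :
    |Real.cosh t - (1 + t ^ 2 / 2 + t ^ 4 / 24 + t ^ 6 / 720)| ≤ t ^ 8 / 1000 := by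
  have h1 := Real.exp_bound ht (n := 8) (by norm_num)
  have h2 := Real.exp_bound (x := -t) (by rwa [abs_neg]) (n := 8) (by norm_num)
  rw [abs_neg] at h2
  have h8 : |t| ^ 8 = t ^ 8 := by
    rw [← abs_pow, abs_of_nonneg (by positivity)]
  rw [h8, abs_le] at h1 h2
  simp only [Finset.sum_range_succ, Finset.sum_range_zero] at h1 h2
  norm_num [Nat.factorial] at h1 h2
  have : 0 ≤ t ^ 8 := by positivity
  rw [abs_le, Real.cosh_eq]
  constructor <;> nlinarith

theorem abs_log_sub_le {w : ℝ} (hw : |w| < 1) :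
    |Real.log (1 + w) - (w - w ^ 2 / 2 + w ^ 3 / 3)| ≤ |w| ^ 4 / (1 - |w|) := by
  have h := Real.abs_log_sub_add_sum_range_le (x := -w) (by rwa [abs_neg]) 3
  rw [abs_neg] at h
  simp only [Finset.sum_range_succ, Finset.sum_range_zero] at h
  norm_num at h
  convert h using 2
  ring

/-- Packing the remainder into a bounded factor ρ makes the later algebra a polynomial identity in T
= t². -/
theorem exists_cosh_sub_one_eq {t : ℝ} (ht : |t| ≤ 1) : ∃ ρ : ℝ, |ρ| ≤ 1 / 1000 ∧
    Real.cosh t - 1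
      = t ^ 2 * (1 / 2 + t ^ 2 / 24 + (t ^ 2) ^ 2 / 720 + (t ^ 2) ^ 3 * ρ) := by
  rcases eq_or_ne t 0 with rfl | h0
  · exact ⟨0, by norm_num, by simp⟩
  · have h8 : 0 < t ^ 8 := by positivity
    refine ⟨(Real.cosh t - (1 + t ^ 2 / 2 + t ^ 4 / 24 + t ^ 6 / 720)) / t ^ 8, ?_, ?_⟩
    · rw [abs_div, abs_of_pos h8, div_le_iff₀ h8]
      linarith [abs_cosh_sub_le ht]
    · field_simp
      ring

theorem abs_mul_le_of_mem_unit {c ρ r : ℝ} (h0 : 0 ≤ c) (h1 : c ≤ 1) (hρ : |ρ| ≤ r) :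
    |c * ρ| ≤ r := by
  rw [abs_mul, abs_of_nonneg h0]
  exact (mul_le_of_le_one_left (abs_nonneg ρ) h1).trans hρ

theorem abs_log_taylor_le {w T P R : ℝ} (hT1 : T ≤ 1) (hw0 : 0 ≤ w)
    (hwT : w ≤ T * (11 / 20)) (hR : |R| ≤ 9)
    (key : w - w ^ 2 / 2 + w ^ 3 / 3 - P = T ^ 4 * R) :
    |Real.log (1 + w) - P| ≤ 10 * T ^ 4 := by
  have hw1 : w ≤ 11 / 20 := by linarith
  have hT4 : 0 ≤ T ^ 4 := by positivity
  have hlog := abs_log_sub_le (w := w) (by rw [abs_of_nonneg hw0]; linarith)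
  rw [abs_of_nonneg hw0] at hlog
  have hlog2 : w ^ 4 / (1 - w) ≤ T ^ 4 := by
    rw [div_le_iff₀ (by linarith)]
    calc w ^ 4 ≤ (T * (11 / 20)) ^ 4 := by gcongr
      _ = T ^ 4 * (11 / 20) ^ 4 := by ring
      _ ≤ T ^ 4 * (1 - w) := by gcongr; linarith
  have hfin : |T ^ 4 * R| ≤ T ^ 4 * 9 := by
    rw [abs_mul, abs_of_nonneg hT4]
    exact mul_le_mul_of_nonneg_left hR hT4
  rw [← key] at hfin
  have := abs_sub_le (Real.log (1 + w)) (w - w ^ 2 / 2 + w ^ 3 / 3) P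
  linarith

/-- The expression is what remains, after division by T⁴, when the Taylor polynomial is subtracted
from w - w²/2 + w³/3 with w = pTa and a = (cosh t - 1)/t². The factor a² + a/2 + 1/4 comes from a³ -
1/8 = (a - 1/2)(a² + a/2 + 1/4). -/
theorem abs_taylor_coeff_le {p T ρ a : ℝ} (hp0 : 0 ≤ p) (hp1 : p ≤ 1) (hT0 : 0 ≤ T) (hT1 : T ≤ 1)
    (hρ : |ρ| ≤ 1 / 1000) (ha0 : 0 ≤ a) (ha1 : a ≤ 11 / 20) :
    |p * ρ - p ^ 2 / 2 * (1 / 576 + 1 / 720 + T / 8640 + T ^ 2 / 518400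
        + 2 * (1 / 2 + T / 24 + T ^ 2 / 720) * (T * ρ) + T ^ 4 * ρ * ρ)
      + p ^ 3 / 3 * ((1 / 24 + T / 720 + T ^ 2 * ρ) * (a ^ 2 + a / 2 + 1 / 4))| ≤ 9 := by
  have hT2 : T ^ 2 ≤ 1 := pow_le_one₀ hT0 hT1
  have hT20 : 0 ≤ T ^ 2 := by positivity
  have hT4 : T ^ 4 ≤ 1 := pow_le_one₀ hT0 hT1
  have hp2 : p ^ 2 ≤ 1 := pow_le_one₀ hp0 hp1
  have hp3 : p ^ 3 ≤ 1 := pow_le_one₀ hp0 hp1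
  have b1 := abs_mul_le_of_mem_unit hp0 hp1 hρ
  have hX : |1 / 576 + 1 / 720 + T / 8640 + T ^ 2 / 518400
        + 2 * (1 / 2 + T / 24 + T ^ 2 / 720) * (T * ρ) + T ^ 4 * ρ * ρ| ≤ 3 := by
    have c1 := abs_mul_le_of_mem_unit hT0 hT1 hρ
    have c2 := abs_mul_le_of_mem_unit (by positivity) hT4 hρ
    have hu : |2 * (1 / 2 + T / 24 + T ^ 2 / 720)| ≤ 2 := by
      rw [abs_of_nonneg (by positivity)]; linarith
    have hz : |1 / 576 + 1 / 720 + T / 8640 + T ^ 2 / 518400| ≤ 1 / 2 := by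
      rw [abs_of_nonneg (by positivity)]; linarith
    have d1 := mul_le_mul hu c1 (abs_nonneg _) (by norm_num)
    have d2 := mul_le_mul c2 hρ (abs_nonneg _) (by norm_num)
    rw [← abs_mul] at d1 d2
    refine (abs_add_three _ _ _).trans ?_
    linarith
  have hZ : |(1 / 24 + T / 720 + T ^ 2 * ρ) * (a ^ 2 + a / 2 + 1 / 4)| ≤ 1 * 2 := by
    have c2 := abs_le.1 (abs_mul_le_of_mem_unit hT20 hT2 hρ)
    have d : |1 / 24 + T / 720 + T ^ 2 * ρ| ≤ 1 := by
      rw [abs_le]; constructor <;> linarith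
    have d' : |a ^ 2 + a / 2 + 1 / 4| ≤ 2 := by
      have : a ^ 2 ≤ 1 := pow_le_one₀ ha0 (by linarith)
      rw [abs_of_nonneg (by positivity)]; linarith
    rw [abs_mul]
    exact mul_le_mul d d' (abs_nonneg _) (by norm_num)
  have k1 := abs_le.1 (abs_mul_le_of_mem_unit (c := p ^ 2 / 2) (by positivity) (by linarith) hX)
  have k2 := abs_le.1 (abs_mul_le_of_mem_unit (c := p ^ 3 / 3) (by positivity) (by linarith) hZ)
  rw [abs_le] at b1 ⊢
  constructor <;> linarith

theorem abs_log_cosh_taylor_le {p t : ℝ} (hp0 : 0 ≤ p) (hp1 : p ≤ 1) (ht : |t| ≤ 1) :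
    |Real.log (1 + p * (Real.cosh t - 1)) - (p / 2 * t ^ 2 + (p / 24 - p ^ 2 / 8) * t ^ 4
      + (p / 720 - p ^ 2 / 48 + p ^ 3 / 24) * t ^ 6)| ≤ 10 * t ^ 8 := by
  have e4 : t ^ 4 = (t ^ 2) ^ 2 := by ring
  have e6 : t ^ 6 = (t ^ 2) ^ 3 := by ring
  have e8 : t ^ 8 = (t ^ 2) ^ 4 := by ring
  obtain ⟨ρ, hρ, hcosh⟩ := exists_cosh_sub_one_eq ht
  rw [hcosh, e4, e6, e8]
  have hT0 : 0 ≤ t ^ 2 := sq_nonneg t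
  have hT1 : t ^ 2 ≤ 1 := (sq_le_one_iff_abs_le_one t).2 ht
  generalize t ^ 2 = T at hT0 hT1
  have hT2 : T ^ 2 ≤ 1 := pow_le_one₀ hT0 hT1
  have hT20 : 0 ≤ T ^ 2 := by positivity
  have h3 := abs_le.1 (abs_mul_le_of_mem_unit (by positivity) (pow_le_one₀ hT0 hT1 (n := 3)) hρ)
  obtain ⟨a, ha⟩ : ∃ a, a = 1 / 2 + T / 24 + T ^ 2 / 720 + T ^ 3 * ρ := ⟨_, rfl⟩
  have ha0 : 0 ≤ a := by linarith
  have ha1 : a ≤ 11 / 20 := by linarith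
  rw [← ha]
  have hwT : p * (T * a) ≤ T * (11 / 20) := by
    calc p * (T * a) ≤ 1 * (T * (11 / 20)) := by gcongr
      _ = _ := one_mul _
  refine abs_log_taylor_le hT1 (by positivity) hwT
    (abs_taylor_coeff_le hp0 hp1 hT0 hT1 hρ ha0 ha1) ?_
  rw [ha]
  ring

/-! ### Scaling limit of the free energy -/

theorem freeEnergy_kAt (l l' δ X : ℝ) :
    freeEnergy (betaC + δ) (kAt l l' δ) X = slopeAt l l' δ / 2 * X ^ 2
      - Real.log (1 + varAt δ * (Real.cosh (slopeAt l l' δ * X) - 1)) := by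
  have := Real.exp_pos (betaC + δ)
  rw [freeEnergy, cumulant_eq_log_cosh, varAt]
  have e : 2 * (betaC + δ) * kAt l l' δ * X = slopeAt l l' δ * X := rfl
  rw [e]
  congr 1
  · rw [slopeAt]; ring
  · congr 1
    field_simp
    ring

theorem abs_scaled_freeEnergy_sub_le {l l' ε x : ℝ} (hε : 0 < ε)
    (hx : |slopeAt l l' (ε ^ 2) * (x * ε)| ≤ 1) :
    |ε⁻¹ ^ 6 * freeEnergy (betaC + ε ^ 2) (kAt l l' (ε ^ 2)) (x * ε)
      - (slopeAt l l' (ε ^ 2) / 2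
          * ((1 - varAt (ε ^ 2) * slopeAt l l' (ε ^ 2)) / (ε ^ 2) ^ 2) * x ^ 2
        + -(varAt (ε ^ 2) / 24 * ((1 - 3 * varAt (ε ^ 2)) / ε ^ 2))
          * slopeAt l l' (ε ^ 2) ^ 4 * x ^ 4
        + -(varAt (ε ^ 2) / 720 - varAt (ε ^ 2) ^ 2 / 48 + varAt (ε ^ 2) ^ 3 / 24)
          * slopeAt l l' (ε ^ 2) ^ 6 * x ^ 6)|
      ≤ 10 * slopeAt l l' (ε ^ 2) ^ 8 * ε ^ 2 * x ^ 8 := by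
  rw [freeEnergy_kAt]
  have h := abs_log_cosh_taylor_le (varAt_pos (ε ^ 2)).le (varAt_le_one (ε ^ 2)) hx
  set b := slopeAt l l' (ε ^ 2)
  set p := varAt (ε ^ 2)
  have h6 : 0 ≤ ε⁻¹ ^ 6 := by positivity
  have h2 := mul_le_mul_of_nonneg_left h h6
  rw [← abs_of_nonneg h6, ← abs_mul, abs_of_nonneg h6] at h2
  rw [abs_sub_comm]
  have hε' : ε ≠ 0 := hε.ne'
  refine (le_of_eq ?_).trans (h2.trans_eq ?_)
  · congr 1
    field_simp
    ring
  · field_simp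

theorem tendsto_sq_nhdsGT_zero : Tendsto (fun ε : ℝ => ε ^ 2) (𝓝[>] 0) (𝓝[>] 0) := by
  refine tendsto_nhdsWithin_iff.2 ⟨?_, ?_⟩
  · have : Tendsto (fun ε : ℝ => ε ^ 2) (𝓝 0) (𝓝 (0 ^ 2)) := (continuous_pow 2).tendsto 0
    rw [zero_pow two_ne_zero] at this
    exact this.mono_left nhdsWithin_le_nhds
  · filter_upwards [self_mem_nhdsWithin] with ε hε
    exact pow_pos (mem_Ioi.1 hε) 2

/-- Uniform convergence of the scaled free energies to the Ginzburg-Landau polynomial. -/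
theorem tendstoUniformlyOn_scaled_freeEnergy (l l' : ℝ) {S : Set ℝ} (hS : IsCompact S) :
    TendstoUniformlyOn
      (fun ε x => ε⁻¹ ^ 6 * freeEnergy (betaC + ε ^ 2) (kAt l l' (ε ^ 2)) (x * ε))
      (gl l) (𝓝[>] 0) S := by
  obtain ⟨R, hR⟩ := hS.isBounded.exists_norm_le
  have hb := (tendsto_slopeAt l l').comp tendsto_sq_nhdsGT_zero
  have hp := tendsto_varAt.comp tendsto_sq_nhdsGT_zero
  have hA := (hb.div_const 2).mul
    ((tendsto_one_sub_varAt_mul_slopeAt l l').comp tendsto_sq_nhdsGT_zero)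
  have hB := (((hp.div_const 24).mul (tendsto_varAt_slope.comp tendsto_sq_nhdsGT_zero)).neg).mul
    (hb.pow 4)
  have hC := ((((hp.div_const 720).sub ((hp.pow 2).div_const 48)).add
    ((hp.pow 3).div_const 24)).neg).mul (hb.pow 6)
  have hid : Tendsto (fun ε : ℝ => ε) (𝓝[>] 0) (𝓝 0) := nhdsWithin_le_nhds
  have hE := (((hb.pow 8).const_mul 10).mul (hid.pow 2)).mul_const (R ^ 8)
  have eA : 3 / 2 * ((iteratedDeriv 2 curveK betaC - l) * betaC / 3)
      = 1 / 2 * betaC * (iteratedDeriv 2 curveK betaC - l) := by ring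
  have eB : -((1 : ℝ) / 3 / 24 * (2 / 3)) * 3 ^ 4 = -(4 * (3 / 16)) := by norm_num
  have eC : -((1 : ℝ) / 3 / 720 - (1 / 3) ^ 2 / 48 + (1 / 3) ^ 3 / 24) * 3 ^ 6 = 9 / 40 := by
    norm_num
  rw [eA] at hA
  rw [eB] at hB
  rw [eC] at hC
  -- For |x| ≤ R all coefficient errors and the remainder are collected into one quantity,
  -- independent of x, that tends to 0.
  have hsum := ((((hA.sub_const (1 / 2 * betaC * (iteratedDeriv 2 curveK betaC - l))).abs.mul_const (R ^ 2)).add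
    ((hB.sub_const (-(4 * (3 / 16)))).abs.mul_const (R ^ 4))).add
    ((hC.sub_const (9 / 40)).abs.mul_const (R ^ 6))).add hE
  have ht := hb.mul (hid.const_mul R)
  simp only [sub_self, abs_zero, zero_mul, mul_zero, ne_eq, OfNat.ofNat_ne_zero, not_false_eq_true,
    zero_pow, add_zero] at hsum ht
  rw [Metric.tendstoUniformlyOn_iff]
  intro η hη
  filter_upwards [hsum.eventually (gt_mem_nhds hη), ht.abs.eventually (gt_mem_nhds (by simp :
    |(0 : ℝ)| < 1)), hb.eventually (lt_mem_nhds (by norm_num : (0 : ℝ) < 3)),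
    self_mem_nhdsWithin] with ε h1 h2 h3 hε x hx
  have hε0 : 0 < ε := hε
  have hxR : |x| ≤ R := hR x hx
  have hR0 : 0 ≤ R := (abs_nonneg x).trans hxR
  simp only [Function.comp] at h1 h2 h3
  have hsmall : |slopeAt l l' (ε ^ 2) * (x * ε)| ≤ 1 := by
    rw [abs_mul, abs_mul, abs_of_pos h3, abs_of_pos hε0]
    rw [abs_of_nonneg (by positivity)] at h2
    refine le_trans ?_ h2.le
    gcongr
  have hmain := abs_scaled_freeEnergy_sub_le hε0 hsmall
  have pw : ∀ n : ℕ, |x ^ n| ≤ R ^ n := fun n => by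
    rw [abs_pow]; gcongr
  have x8 : x ^ 8 ≤ R ^ 8 := (le_abs_self _).trans (pw 8)
  rw [Real.dist_eq, abs_sub_comm]
  refine lt_of_le_of_lt ?_ h1
  refine (abs_sub_le _ _ _).trans ((add_le_add_left hmain _).trans ?_)
  rw [add_comm]
  refine add_le_add ?_ (by gcongr)
  rw [gl]
  refine le_trans (le_of_eq ?_) ((abs_add_three _ _ _).trans (add_le_add (add_le_add
    ((abs_mul _ _).trans_le (mul_le_mul_of_nonneg_left (pw 2) (abs_nonneg _)))
    ((abs_mul _ _).trans_le (mul_le_mul_of_nonneg_left (pw 4) (abs_nonneg _))))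
    ((abs_mul _ _).trans_le (mul_le_mul_of_nonneg_left (pw 6) (abs_nonneg _)))))
  congr 1
  ring

/-! ### Minimizers of the Ginzburg-Landau polynomial -/

/-- The quadratic coefficient of the Ginzburg-Landau polynomial, times two. -/
noncomputable def glCoeff (l : ℝ) : ℝ := betaC * (iteratedDeriv 2 curveK betaC - l)

theorem gl_eq (l x : ℝ) :
    gl l x = glCoeff l / 2 * x ^ 2 - 3 / 4 * x ^ 4 + 9 / 40 * x ^ 6 := by
  rw [gl, glCoeff]; ring

theorem ellC_eq_sub : ellC = iteratedDeriv 2 curveK betaC - 5 / (4 * betaC) := by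
  have := betaC_pos
  rw [iteratedDeriv_two_curveK, ellC]
  field_simp
  ring

theorem ellC_eq_div : ellC = (-betaC ^ 2 - 8 * betaC + 12) / (4 * betaC ^ 3) := by
  have := betaC_pos
  rw [ellC]
  field_simp
  ring

/-- 5/4 is the value of D at which D/2 - (3/4)y + (9/40)y², with y = x², has a double root; that
root is y = 5/3. -/
theorem glCoeff_ellC : glCoeff ellC = 5 / 4 := by
  have := betaC_pos
  rw [glCoeff, ellC_eq_sub]
  field_simp
  ring

theorem glCoeff_sub (l : ℝ) : glCoeff l - 5 / 4 = betaC * (ellC - l) := by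
  rw [← glCoeff_ellC, glCoeff, glCoeff]; ring

theorem glCoeff_le {l : ℝ} (h : ellC ≤ l) : glCoeff l ≤ 5 / 4 := by
  have := glCoeff_sub l
  have := mul_nonneg betaC_pos.le (sub_nonneg.2 h)
  linarith

theorem glCoeff_lt {l : ℝ} (h : ellC < l) : glCoeff l < 5 / 4 := by
  have := glCoeff_sub l
  have := mul_pos betaC_pos (sub_pos.2 h)
  linarith

theorem lt_glCoeff {l : ℝ} (h : l < ellC) : 5 / 4 < glCoeff l := by
  have := glCoeff_sub l
  have := mul_pos betaC_pos (sub_pos.2 h)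
  linarith

theorem xBar_eq (l : ℝ) : xBar l = √10 / 3 * √(1 + √(1 - 3 * glCoeff l / 5)) := by
  rw [xBar, glCoeff]
  congr 4
  ring

theorem xBar_pos (l : ℝ) : 0 < xBar l := by
  have := Real.sqrt_nonneg (1 - 3 * glCoeff l / 5)
  rw [xBar_eq]
  positivity

theorem xBar_sq (l : ℝ) : xBar l ^ 2 = 10 / 9 * (1 + √(1 - 3 * glCoeff l / 5)) := by
  rw [xBar_eq, mul_pow, div_pow, Real.sq_sqrt (by norm_num), Real.sq_sqrt (by positivity)]
  norm_num

theorem xBar_ellC : xBar ellC = √(5 / 3) := by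
  rw [← Real.sqrt_sq (xBar_pos ellC).le, xBar_sq, glCoeff_ellC]
  have : (1 - 3 * (5 / 4) / 5 : ℝ) = (1 / 2) ^ 2 := by norm_num
  rw [this, Real.sqrt_sq (by norm_num)]
  norm_num

theorem half_le_sqrt {l : ℝ} (h : ellC ≤ l) : 1 / 2 ≤ √(1 - 3 * glCoeff l / 5) := by
  apply Real.le_sqrt_of_sq_le
  have := glCoeff_le h
  linarith

theorem half_lt_sqrt {l : ℝ} (h : ellC < l) : 1 / 2 < √(1 - 3 * glCoeff l / 5) := by
  apply Real.lt_sqrt_of_sq_lt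
  have := glCoeff_lt h
  linarith

/-- As a cubic in x², the difference has a double root at x̄². The remaining factor is nonnegative
because the inner square root is at least 1/2 exactly when D ≤ 5/4. -/
theorem gl_sub_gl_xBar {l : ℝ} (h : ellC ≤ l) (x : ℝ) :
    gl l x - gl l (xBar l) = 9 / 40 * (x ^ 2 - xBar l ^ 2) ^ 2
      * (x ^ 2 + 20 / 9 * (√(1 - 3 * glCoeff l / 5) - 1 / 2)) := by
  have hD := glCoeff_le h
  have hs := Real.sq_sqrt (by linarith : 0 ≤ 1 - 3 * glCoeff l / 5)
  have e4 : xBar l ^ 4 = (xBar l ^ 2) ^ 2 := by ring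
  have e6 : xBar l ^ 6 = (xBar l ^ 2) ^ 3 := by ring
  rw [gl_eq, gl_eq, e4, e6, xBar_sq]
  set σ := √(1 - 3 * glCoeff l / 5)
  have hD' : glCoeff l = 5 / 3 * (1 - σ ^ 2) := by linarith
  rw [hD']
  ring

theorem xBar_mem_globalMinPoints {l : ℝ} (h : ellC ≤ l) : xBar l ∈ globalMinPoints (gl l) := by
  intro y
  have h1 := gl_sub_gl_xBar h y
  have h2 := half_le_sqrt h
  have : 0 ≤ 9 / 40 * (y ^ 2 - xBar l ^ 2) ^ 2
      * (y ^ 2 + 20 / 9 * (√(1 - 3 * glCoeff l / 5) - 1 / 2)) :=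
    mul_nonneg (by positivity) (add_nonneg (sq_nonneg y) (by linarith))
  linarith

theorem gl_zero (l : ℝ) : gl l 0 = 0 := by simp [gl]

theorem gl_even {l x y : ℝ} (h : x ^ 2 = y ^ 2) : gl l x = gl l y := by
  have e : ∀ z : ℝ, gl l z = glCoeff l / 2 * z ^ 2 - 3 / 4 * (z ^ 2) ^ 2 + 9 / 40 * (z ^ 2) ^ 3 :=
    fun z => by rw [gl_eq]; ring
  rw [e, e, h]

theorem globalMinPoints_gl_cases {l x : ℝ} (h : ellC ≤ l) (hx : x ∈ globalMinPoints (gl l)) :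
    x = xBar l ∨ x = -xBar l ∨ x = 0 ∧ l = ellC := by
  have h1 := gl_sub_gl_xBar h x
  have h0 : gl l x - gl l (xBar l) = 0 :=
    sub_eq_zero.2 (le_antisymm (hx _) (xBar_mem_globalMinPoints h _))
  rw [h0] at h1
  rcases mul_eq_zero.1 h1.symm with h2 | h2
  · have : x ^ 2 = xBar l ^ 2 := by
      have := (mul_eq_zero.1 h2).resolve_left (by norm_num)
      have := pow_eq_zero_iff two_ne_zero |>.1 this
      linarith
    rcases sq_eq_sq_iff_eq_or_eq_neg.1 this with h3 | h3
    · exact Or.inl h3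
    · exact Or.inr (Or.inl h3)
  · right; right
    have := half_le_sqrt h
    have hx2 : x ^ 2 = 0 := by nlinarith [sq_nonneg x]
    refine ⟨by simpa using hx2, ?_⟩
    by_contra hne
    have := half_lt_sqrt (lt_of_le_of_ne h (Ne.symm hne))
    rw [hx2] at h2
    linarith

theorem globalMinPoints_gl_of_lt {l : ℝ} (h : ellC < l) :
    globalMinPoints (gl l) = {xBar l, -xBar l} := by
  ext x
  simp only [mem_insert_iff, mem_singleton_iff]
  constructor
  · intro hx
    rcases globalMinPoints_gl_cases h.le hx with h1 | h1 | ⟨_, h1⟩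
    · exact Or.inl h1
    · exact Or.inr h1
    · exact absurd h1 h.ne'
  · rintro (rfl | rfl)
    · exact xBar_mem_globalMinPoints h.le
    · intro y
      rw [gl_even (neg_sq (xBar l))]
      exact xBar_mem_globalMinPoints h.le y

theorem gl_xBar_ellC : gl ellC (xBar ellC) = 0 := by
  have h := gl_sub_gl_xBar le_rfl (0 : ℝ)
  have : (1 - 3 * (5 / 4) / 5 : ℝ) = (1 / 2) ^ 2 := by norm_num
  rw [gl_zero, glCoeff_ellC, this, Real.sqrt_sq (by norm_num)] at h
  norm_num at h
  linarith

theorem globalMinPoints_gl_ellC :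
    globalMinPoints (gl ellC) = {0, xBar ellC, -xBar ellC} := by
  ext x
  simp only [mem_insert_iff, mem_singleton_iff]
  constructor
  · intro hx
    rcases globalMinPoints_gl_cases le_rfl hx with h1 | h1 | ⟨h1, _⟩
    · exact Or.inr (Or.inl h1)
    · exact Or.inr (Or.inr h1)
    · exact Or.inl h1
  · rintro (rfl | rfl | rfl)
    · intro y
      rw [gl_zero, ← gl_xBar_ellC]
      exact xBar_mem_globalMinPoints le_rfl y
    · exact xBar_mem_globalMinPoints le_rfl
    · intro y
      rw [gl_even (neg_sq (xBar ellC))]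
      exact xBar_mem_globalMinPoints le_rfl y

theorem exists_ne_zero_mem_globalMinPoints_gl_iff (l : ℝ) :
    (∃ x ∈ globalMinPoints (gl l), x ≠ 0) ↔ ellC ≤ l := by
  constructor
  · rintro ⟨x, hx, hx0⟩
    by_contra hl
    have hD := lt_glCoeff (not_le.1 hl)
    have h := hx 0
    rw [gl_zero, gl_eq] at h
    have hx2 : 0 < x ^ 2 := by positivity
    -- Completing the square in x² writes g_ℓ(x) in this form.
    have : 0 < x ^ 2 * ((glCoeff l - 5 / 4) / 2 + 9 / 40 * (x ^ 2 - 5 / 3) ^ 2) :=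
      mul_pos hx2 (by have := sq_nonneg (x ^ 2 - 5 / 3); linarith)
    nlinarith
  · intro h
    exact ⟨xBar l, xBar_mem_globalMinPoints h, (xBar_pos l).ne'⟩

theorem gl_xBar_neg {l : ℝ} (h : ellC < l) : gl l (xBar l) < 0 := by
  have h1 := gl_sub_gl_xBar h.le 0
  have h2 := half_lt_sqrt h
  have hx := xBar_pos l
  have : 0 < 9 / 40 * ((0 : ℝ) ^ 2 - xBar l ^ 2) ^ 2
      * ((0 : ℝ) ^ 2 + 20 / 9 * (√(1 - 3 * glCoeff l / 5) - 1 / 2)) := by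
    apply mul_pos
    · have : (0 : ℝ) ^ 2 - xBar l ^ 2 ≠ 0 := by
        have := pow_pos hx 2
        linarith
      positivity
    · linarith
  rw [gl_zero] at h1
  linarith

/-! ### Localization and convergence of the rescaled magnetization -/

theorem eventually_kAt_pos (l l' : ℝ) : ∀ᶠ ε in 𝓝[>] (0 : ℝ), 0 < kAt l l' (ε ^ 2) := by
  have hb := betaC_pos
  refine ((tendsto_kAt l l').comp tendsto_sq_nhdsGT_zero).eventually (lt_mem_nhds ?_)
  rw [curveK_betaC]
  positivity

theorem betaC_add_sq_pos (ε : ℝ) : 0 < betaC + ε ^ 2 := by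
  have hb := betaC_pos
  positivity

/-- A quadratic inequality in V = (by)², where b is the slope. Its leading coefficient tends to
1/180, which bounds V above. Its constant term tends to D/3, which is 5/12 > 0 at ℓ = ℓ_c and bounds
V away from 0. -/
theorem exists_bounds_of_quadratic (l l' : ℝ) : ∃ c C : ℝ, 0 ≤ c ∧ (l = ellC → 0 < c) ∧
    ∀ᶠ ε in 𝓝[>] (0 : ℝ), ∀ y : ℝ, 0 < y →
      (1 - varAt (ε ^ 2) * slopeAt l l' (ε ^ 2)) / (ε ^ 2) ^ 2
          / (varAt (ε ^ 2) * slopeAt l l' (ε ^ 2))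
        + (3 / slopeAt l l' (ε ^ 2) - 1) / 6 / ε ^ 2 * (slopeAt l l' (ε ^ 2) * y) ^ 2
        + (5 / slopeAt l l' (ε ^ 2) - 1) / 120 * ((slopeAt l l' (ε ^ 2) * y) ^ 2) ^ 2 ≤ 0 →
      y ∈ Icc c C := by
  set H := |glCoeff l / 3| + 1 with hH
  have hHpos : 0 < H := by positivity
  -- Eventually the coefficients exceed -H, -1 and 1/200, so V ≤ 400 + H. At ℓ_c the constant term
  -- exceeds 5/24, so V ≥ 5/24, and b² ≤ 16 gives y > 1/10.
  refine ⟨if l = ellC then 1 / 10 else 0, 1 + (400 + H), by split_ifs <;> norm_num,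
    fun h => by rw [if_pos h]; norm_num, ?_⟩
  have hb := tendsto_slopeAt l l'
  have hv := tendsto_varAt.mul hb
  have hid : Tendsto (fun δ : ℝ => δ) (𝓝[>] 0) (𝓝 0) := nhdsWithin_le_nhds
  have hq := tendsto_one_sub_varAt_mul_slopeAt l l'
  have h1 := hq.div hv (by norm_num)
  have e1 : (iteratedDeriv 2 curveK betaC - l) * betaC / 3 / (1 / 3 * 3) = glCoeff l / 3 := by
    rw [glCoeff]; ring
  rw [e1] at h1
  have h2 := ((((hq.mul hid).sub tendsto_varAt_slope).div hv (by norm_num)).div_const 6)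
  have h3 := ((((tendsto_const_nhds (x := (5 : ℝ))).div hb (by norm_num)).sub_const 1).div_const 120)
  have e2 : ((iteratedDeriv 2 curveK betaC - l) * betaC / 3 * 0 - 2 / 3) / (1 / 3 * 3) / 6
      = -(1 / 9) := by norm_num
  rw [e2] at h2
  have c1 : ∀ᶠ δ in 𝓝[>] (0 : ℝ),
      -H < (1 - varAt δ * slopeAt l l' δ) / δ ^ 2 / (varAt δ * slopeAt l l' δ) :=
    h1.eventually (lt_mem_nhds (by rw [hH]; linarith [neg_abs_le (glCoeff l / 3)]))
  have c1' : ∀ᶠ δ in 𝓝[>] (0 : ℝ), l = ellC →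
      5 / 24 < (1 - varAt δ * slopeAt l l' δ) / δ ^ 2 / (varAt δ * slopeAt l l' δ) := by
    by_cases hl : l = ellC
    · filter_upwards [h1.eventually (lt_mem_nhds (a := 5 / 24) (by
        rw [hl, glCoeff_ellC]; norm_num))] with δ hδ _ using hδ
    · exact Eventually.of_forall fun _ h => absurd h hl
  have c2 : ∀ᶠ δ in 𝓝[>] (0 : ℝ), -1 < ((1 - varAt δ * slopeAt l l' δ) / δ ^ 2 * δ
      - (1 - 3 * varAt δ) / δ) / (varAt δ * slopeAt l l' δ) / 6 :=
    h2.eventually (lt_mem_nhds (by norm_num : (-1 : ℝ) < -(1 / 9)))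
  have c3 : ∀ᶠ δ in 𝓝[>] (0 : ℝ), 1 / 200 < (5 / slopeAt l l' δ - 1) / 120 :=
    h3.eventually (lt_mem_nhds (by norm_num : (1 / 200 : ℝ) < (5 / 3 - 1) / 120))
  have c4 := hb.eventually (lt_mem_nhds (by norm_num : (2 : ℝ) < 3))
  have c5 := hb.eventually (gt_mem_nhds (by norm_num : (3 : ℝ) < 4))
  have call := tendsto_sq_nhdsGT_zero.eventually
    (c1.and (c1'.and (c2.and (c3.and (c4.and c5)))))
  filter_upwards [call, self_mem_nhdsWithin] with ε ⟨d1, d1', d2, d3, d4, d5⟩ hε y hy hineq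
  have hε0 : (0 : ℝ) < ε := hε
  have hb0 : 0 < slopeAt l l' (ε ^ 2) := by linarith
  have hp0 := varAt_pos (ε ^ 2)
  set b := slopeAt l l' (ε ^ 2)
  set p := varAt (ε ^ 2)
  have d2' : -1 < (3 / b - 1) / 6 / ε ^ 2 := by
    convert d2 using 1
    field_simp
    ring
  set q := (1 - p * b) / (ε ^ 2) ^ 2 / (p * b)
  set V := (b * y) ^ 2 with hV
  have hV0 : 0 < V := by positivity
  have hVy : V = b ^ 2 * y ^ 2 := by rw [hV]; ring
  have hlin : -V ≤ (3 / b - 1) / 6 / ε ^ 2 * V := by nlinarith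
  have hquad : 1 / 200 * V ^ 2 ≤ (5 / b - 1) / 120 * V ^ 2 :=
    mul_le_mul_of_nonneg_right d3.le (by positivity)
  have hVle : V ≤ 400 + H := by
    by_contra hcon
    have h5 : 400 + H < V := not_le.1 hcon
    nlinarith
  have hb2 : 4 ≤ b ^ 2 := by nlinarith
  have hb16 : b ^ 2 ≤ 16 := by nlinarith
  have hy2 : 0 < y ^ 2 := by positivity
  constructor
  · split_ifs with hl
    · have := d1' hl
      have hlow : 5 / 24 ≤ V := by nlinarith [sq_nonneg V]
      by_contra hcon
      have : y < 1 / 10 := not_le.1 hcon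
      nlinarith
    · exact hy.le
  · nlinarith [sq_nonneg (y - 1)]

/-- Apply `quartic_nonpos_of_critical` at t = bm, with b the slope, and divide by ε⁴. -/
theorem exists_bounds_scaled_isMin (l l' : ℝ) : ∃ c C : ℝ, 0 ≤ c ∧ (l = ellC → 0 < c) ∧
    ∀ᶠ ε in 𝓝[>] (0 : ℝ), ∀ m : ℝ, 0 < m →
      m ∈ globalMinPoints (freeEnergy (betaC + ε ^ 2) (kAt l l' (ε ^ 2))) → m / ε ∈ Icc c C := by
  obtain ⟨c, C, h0, h1, h2⟩ := exists_bounds_of_quadratic l l'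
  refine ⟨c, C, h0, h1, ?_⟩
  filter_upwards [h2, eventually_kAt_pos l l', self_mem_nhdsWithin,
    ((tendsto_slopeAt l l').comp tendsto_sq_nhdsGT_zero).eventually
      (gt_mem_nhds (by norm_num : (3 : ℝ) < 4))] with ε h2 hK hε hb4 m hm hmin
  have hε0 : (0 : ℝ) < ε := hε
  have hβ := betaC_add_sq_pos ε
  apply h2 _ (by positivity)
  have hcrit := critical_equation hβ hK (eq_tiltedMean_of_isMin hβ hK hmin)
  have hb0 : 0 < slopeAt l l' (ε ^ 2) := by rw [slopeAt]; positivity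
  have hbe : 2 * (betaC + ε ^ 2) * kAt l l' (ε ^ 2) = slopeAt l l' (ε ^ 2) := rfl
  rw [hbe] at hcrit
  simp only [Function.comp] at hb4
  have hq := quartic_nonpos_of_critical (by
    rw [div_le_div_iff₀ (by norm_num) hb0]; linarith) (by positivity) hcrit
  have hp : Real.exp (betaC + ε ^ 2) + 2 = 2 / varAt (ε ^ 2) := by
    rw [varAt]
    have := Real.exp_pos (betaC + ε ^ 2)
    field_simp
  rw [hp] at hq
  have hp0 := varAt_pos (ε ^ 2)
  have hε4 : 0 < (ε ^ 2) ^ 2 := by positivity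
  refine le_of_mul_le_mul_left ?_ hε4
  rw [mul_zero]
  refine le_trans (le_of_eq ?_) hq
  field_simp

theorem continuous_gl (l : ℝ) : Continuous (gl l) := by
  unfold gl; fun_prop

/-- If the free energies take negative values near the tricritical point, the rescaled
magnetization converges to `x̄(ℓ)`. -/
theorem tendsto_magnetization_div {l l' : ℝ} (hl : ellC ≤ l)
    (hneg : ∀ᶠ ε in 𝓝[>] (0 : ℝ), ∃ x, freeEnergy (betaC + ε ^ 2) (kAt l l' (ε ^ 2)) x < 0) :
    Tendsto (fun ε => magnetization (betaC + ε ^ 2) (kAt l l' (ε ^ 2)) / ε) (𝓝[>] 0)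
      (𝓝 (xBar l)) := by
  obtain ⟨c, C, hc0, hc, hbd⟩ := exists_bounds_scaled_isMin l l'
  have hmin : ∀ᶠ ε in 𝓝[>] (0 : ℝ), magnetization (betaC + ε ^ 2) (kAt l l' (ε ^ 2)) ∈
      globalMinPoints (freeEnergy (betaC + ε ^ 2) (kAt l l' (ε ^ 2))) ∧
      magnetization (betaC + ε ^ 2) (kAt l l' (ε ^ 2)) / ε ∈ Icc c C := by
    filter_upwards [hneg, eventually_kAt_pos l l', hbd] with ε ⟨x, hx⟩ hK hb
    obtain ⟨h1, h2, -⟩ := equilibriumSet_of_freeEnergy_neg (betaC_add_sq_pos ε) hK hx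
    exact ⟨h2, hb _ h1 h2⟩
  refine isCompact_Icc.tendsto_nhds_of_unique_mapClusterPt (hmin.mono fun _ h => h.2) ?_
  intro y hy hcl
  obtain ⟨U, hU, hUy⟩ := mapClusterPt_iff_ultrafilter.1 hcl
  have hglob : y ∈ globalMinPoints (gl l) := by
    intro z
    apply le_of_forall_pos_le_add
    intro η hη
    refine le_of_tendsto (((continuous_gl l).tendsto y).comp hUy) (hU ?_)
    -- The comparison involves a moving point m/ε in [c, C] and the fixed point z, so uniformity is
    -- needed on their union.
    have hunif := Metric.tendstoUniformlyOn_iff.1 (tendstoUniformlyOn_scaled_freeEnergy l l'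
      ((isCompact_Icc (a := c) (b := C)).union (isCompact_singleton (x := z)))) (η / 2)
      (by positivity)
    filter_upwards [hunif, hmin, self_mem_nhdsWithin] with ε h1 ⟨h2, h3⟩ hε
    have hε0 : (0 : ℝ) < ε := hε
    have k1 := h1 _ (Or.inl h3)
    have k2 := h1 z (Or.inr rfl)
    rw [div_mul_cancel₀ _ hε0.ne'] at k1
    have k3 := mul_le_mul_of_nonneg_left (h2 (z * ε)) (by positivity : 0 ≤ ε⁻¹ ^ 6)
    rw [Real.dist_eq, abs_lt] at k1 k2
    simp only [Function.comp]
    linarith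
  have hx := xBar_pos l
  -- The bound c ≥ 0 excludes -x̄; the value 0 is a candidate only at ℓ_c, where c > 0.
  rcases globalMinPoints_gl_cases hl hglob with h | h | ⟨h, h'⟩
  · exact h
  · have := hy.1
    linarith
  · have := hy.1
    have := hc h'
    linarith

/-! ### Negative values of the free energy -/

theorem eventually_freeEnergy_neg_of_lt {l : ℝ} (hl : ellC < l) (l' : ℝ) :
    ∀ᶠ ε in 𝓝[>] (0 : ℝ), ∃ x, freeEnergy (betaC + ε ^ 2) (kAt l l' (ε ^ 2)) x < 0 := by
  have h := (tendstoUniformlyOn_scaled_freeEnergy l l'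
    (isCompact_singleton (x := xBar l))).tendsto_at (mem_singleton _)
  filter_upwards [h.eventually (gt_mem_nhds (gl_xBar_neg hl)), self_mem_nhdsWithin] with ε h1 hε
  have hε0 : (0 : ℝ) < ε := hε
  exact ⟨_, (pos_iff_neg_of_mul_neg h1).1 (by positivity)⟩

theorem exists_mem_phaseCoexistence {β : ℝ} (hβ : 0 < β) : ∃ K, (β, K) ∈ phaseCoexistence := by
  set L := Real.log (Real.exp β + 2) with hL
  have hL0 : 0 < L := Real.log_pos (by linarith [Real.exp_pos β])
  have hK : 0 < 2 * L / β := by positivity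
  -- With c_β(t) ≥ |t| - L, the value is at most L/2 - (2L - L) = -L/2.
  have hneg : freeEnergy β (2 * L / β) (1 / 2) < 0 := by
    have h := abs_sub_log_le_cumulant β (2 * β * (2 * L / β) * (1 / 2))
    have e : 2 * β * (2 * L / β) * (1 / 2) = 2 * L := by field_simp
    have e' : β * (2 * L / β) * (1 / 2) ^ 2 = L / 2 := by field_simp
    rw [e, abs_of_pos (by positivity), ← hL] at h
    rw [freeEnergy, e, e']
    linarith
  obtain ⟨h1, -, h3⟩ := equilibriumSet_of_freeEnergy_neg hβ hK hneg
  refine ⟨2 * L / β, hβ, hK, ?_⟩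
  simp only [h3]
  exact nontrivial_pair (by linarith)

/-- Above the first-order curve the free energy takes negative values. -/
theorem exists_freeEnergy_neg_of_curveK1_lt {β K : ℝ} (hβ : 0 < β) (hβc : β ≠ betaC)
    (h : curveK1 β < K) : ∃ x, freeEnergy β K x < 0 := by
  rw [curveK1, if_neg hβc] at h
  obtain ⟨K₀, ⟨-, hK₀, hnt⟩, hlt⟩ := exists_lt_of_csInf_lt (exists_mem_phaseCoexistence hβ) h
  simp only at hK₀ hnt
  obtain ⟨x, hx, hx0⟩ := hnt.exists_ne 0
  rw [equilibriumSet_eq_globalMinPoints hβ hK₀] at hx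
  have hle := hx 0
  rw [freeEnergy_zero, freeEnergy] at hle
  have hK : 0 < K := hK₀.trans hlt
  -- This rescaling keeps the argument 2βKx of c_β fixed while the quadratic term shrinks by the
  -- factor K₀/K < 1, so a value ≤ 0 at K₀ becomes negative at K.
  refine ⟨K₀ / K * x, ?_⟩
  have e : 2 * β * K * (K₀ / K * x) = 2 * β * K₀ * x := by field_simp
  rw [freeEnergy, e]
  have e2 : β * K * (K₀ / K * x) ^ 2 = β * K₀ * x ^ 2 * (K₀ / K) := by field_simp
  have hlt1 : K₀ / K < 1 := (div_lt_one hK).2 hlt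
  have hpos : 0 < β * K₀ * x ^ 2 := by positivity
  rw [e2]
  nlinarith

theorem curveK1_betaC : curveK1 betaC = curveK betaC := by rw [curveK1, if_pos rfl]

theorem HasRightDeriv.iteratedDerivWithin_eq {f : ℝ → ℝ} {a d : ℝ} {k : ℕ}
    (h : HasRightDeriv f a (k + 1) d) : iteratedDerivWithin (k + 1) f (Ici a) a = d := by
  rw [iteratedDerivWithin_succ]
  exact h.2.derivWithin (uniqueDiffOn_Ici a a self_mem_Ici)

theorem HasRightDeriv.eventually_hasDerivWithinAt {f : ℝ → ℝ} {a d : ℝ} {k i : ℕ}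
    (h : HasRightDeriv f a (k + 1) d) (hi : i < k) :
    ∀ᶠ x in 𝓝[≥] a, HasDerivWithinAt (iteratedDerivWithin i f (Ici a))
      (iteratedDerivWithin (i + 1) f (Ici a) x) (Ici a) x := by
  filter_upwards [h.1 i hi] with x hx
  rw [iteratedDerivWithin_succ]
  exact hx.hasDerivWithinAt

/-- Conjectures 1 and 2 make K₁ and `kAt` agree through second order, so the third-order
coefficients decide. -/
theorem eventually_curveK1_lt_kAt {l' : ℝ} (h1 : Conjecture1) (h2 : Conjecture2)
    (h3 : Conjecture3) (hl' : iteratedDerivWithin 3 curveK1 (Ici betaC) betaC < l') :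
    ∀ᶠ δ in 𝓝[>] (0 : ℝ), curveK1 (betaC + δ) < kAt ellC l' δ := by
  obtain ⟨d, -, hd⟩ := h3
  rw [hd.iteratedDerivWithin_eq] at hl'
  have ht := taylor_three_isLittleO (hd.eventually_hasDerivWithinAt (i := 0) (by norm_num))
    (hd.eventually_hasDerivWithinAt (i := 1) (by norm_num)) hd.2
  have e1 : iteratedDerivWithin (0 + 1) curveK1 (Ici betaC) betaC = deriv curveK betaC :=
    HasRightDeriv.iteratedDerivWithin_eq h1
  have e2 : iteratedDerivWithin (1 + 1) curveK1 (Ici betaC) betaC = ellC :=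
    HasRightDeriv.iteratedDerivWithin_eq h2.1
  rw [e1, e2] at ht
  simp only [iteratedDerivWithin_zero, curveK1_betaC] at ht
  have hlim := (ht.comp_tendsto tendsto_betaC_add_nhdsGE).tendsto_div_nhds_zero
  filter_upwards [hlim.eventually (gt_mem_nhds (by linarith : 0 < (l' - d) / 6)),
    self_mem_nhdsWithin] with δ hδ hpos
  have hδ0 : (0 : ℝ) < δ := hpos
  simp only [Function.comp, add_sub_cancel_left] at hδ
  rw [div_lt_iff₀ (by positivity)] at hδ
  rw [kAt]
  linarith

theorem eventually_freeEnergy_neg_of_conjectures {l' : ℝ} (h1 : Conjecture1) (h2 : Conjecture2)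
    (h3 : Conjecture3) (hl' : iteratedDerivWithin 3 curveK1 (Ici betaC) betaC < l') :
    ∀ᶠ ε in 𝓝[>] (0 : ℝ), ∃ x, freeEnergy (betaC + ε ^ 2) (kAt ellC l' (ε ^ 2)) x < 0 := by
  filter_upwards [tendsto_sq_nhdsGT_zero.eventually (eventually_curveK1_lt_kAt h1 h2 h3 hl'),
    self_mem_nhdsWithin] with ε hε hpos
  have hε0 : (0 : ℝ) < ε := hpos
  have : 0 < ε ^ 2 := by positivity
  exact exists_freeEnergy_neg_of_curveK1_lt (betaC_add_sq_pos ε) (by linarith) hε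

/-! ### Passage to the sequence -/

/-- The scale `n^{-α/2}` of the spin variable. -/
noncomputable def scaleSeq (α : ℝ) (n : ℕ) : ℝ := 1 / (n : ℝ) ^ (α / 2)

theorem scaleSeq_pow (α : ℝ) (n k : ℕ) :
    scaleSeq α n ^ k = 1 / (n : ℝ) ^ (α / 2 * k) := by
  rw [scaleSeq, div_pow, one_pow, Real.rpow_mul_natCast (Nat.cast_nonneg n)]

theorem betaSeq_eq (α : ℝ) (n : ℕ) : betaSeq α n = betaC + scaleSeq α n ^ 2 := by
  rw [betaSeq, scaleSeq_pow]
  congr 3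
  push_cast
  ring

theorem kSeq_eq (α l l' : ℝ) (n : ℕ) : kSeq α l l' n = kAt l l' (scaleSeq α n ^ 2) := by
  have e1 : α / 2 * ((2 : ℕ) : ℝ) = α := by push_cast; ring
  have e2 : α / 2 * ((2 * 2 : ℕ) : ℝ) = 2 * α := by push_cast; ring
  have e3 : α / 2 * ((2 * 3 : ℕ) : ℝ) = 3 * α := by push_cast; ring
  rw [kSeq, kAt, ← pow_mul, ← pow_mul, scaleSeq_pow, scaleSeq_pow, scaleSeq_pow, e1, e2, e3]
  simp only [div_eq_mul_inv, mul_inv, one_mul]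
  ring

theorem tendsto_scaleSeq {α : ℝ} (hα : 0 < α) : Tendsto (scaleSeq α) atTop (𝓝[>] 0) := by
  have h := (tendsto_rpow_atTop (half_pos hα)).comp tendsto_natCast_atTop_atTop
  refine tendsto_nhdsWithin_iff.2 ⟨?_, ?_⟩
  · exact h.inv_tendsto_atTop.congr fun n => (one_div _).symm
  · filter_upwards [eventually_gt_atTop 0] with n hn
    have : (0 : ℝ) < n := by exact_mod_cast hn
    simp only [scaleSeq, mem_Ioi]
    positivity

end BlumeCapel

open BlumeCapel in
theorem theorem5p2 (α l l' : ℝ) (hα : 0 < α) :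
    -- convergence to the tricritical point
    Tendsto (fun n : ℕ => (BlumeCapel.betaSeq α n, BlumeCapel.kSeq α l l' n)) atTop
      (𝓝 (BlumeCapel.betaC, BlumeCapel.curveK BlumeCapel.betaC)) ∧
    -- (a)
    (∀ S : Set ℝ, IsCompact S →
      TendstoUniformlyOn
        (fun (n : ℕ) (x : ℝ) => (n : ℝ) ^ (1 - (1 - 3 * α)) *
          BlumeCapel.freeEnergy (BlumeCapel.betaSeq α n) (BlumeCapel.kSeq α l l' n)
            (x / (n : ℝ) ^ (α / 2)))
        (BlumeCapel.gl l) atTop S) ∧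
    -- (b)
    (BlumeCapel.ellC = iteratedDeriv 2 BlumeCapel.curveK BlumeCapel.betaC
        - 5 / (4 * BlumeCapel.betaC) ∧
      BlumeCapel.ellC = (-BlumeCapel.betaC ^ 2 - 8 * BlumeCapel.betaC + 12)
        / (4 * BlumeCapel.betaC ^ 3) ∧
      ((∃ x ∈ BlumeCapel.globalMinPoints (BlumeCapel.gl l), x ≠ 0) ↔ BlumeCapel.ellC ≤ l) ∧
      (BlumeCapel.ellC < l → 0 < BlumeCapel.xBar l ∧
        BlumeCapel.globalMinPoints (BlumeCapel.gl l)
          = {BlumeCapel.xBar l, -BlumeCapel.xBar l}) ∧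
      (l = BlumeCapel.ellC → BlumeCapel.xBar l = √(5 / 3) ∧
        BlumeCapel.globalMinPoints (BlumeCapel.gl l)
          = {0, BlumeCapel.xBar l, -BlumeCapel.xBar l})) ∧
    -- (c)
    ((iteratedDeriv 2 BlumeCapel.curveK BlumeCapel.betaC < l ∨
      (l = iteratedDeriv 2 BlumeCapel.curveK BlumeCapel.betaC ∧
        iteratedDeriv 3 BlumeCapel.curveK BlumeCapel.betaC < l') ∨
      (l < iteratedDeriv 2 BlumeCapel.curveK BlumeCapel.betaC ∧ BlumeCapel.ellC < l ∧
        BlumeCapel.Conjecture1 ∧ BlumeCapel.Conjecture2) ∨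
      (l = BlumeCapel.ellC ∧
        iteratedDerivWithin 3 BlumeCapel.curveK1 (Ici BlumeCapel.betaC) BlumeCapel.betaC < l' ∧
        BlumeCapel.Conjecture1 ∧ BlumeCapel.Conjecture2 ∧ BlumeCapel.Conjecture3)) →
      -- eventually the sequence is in the phase-coexistence region and `m` is well defined there
      (∀ᶠ n : ℕ in atTop,
        (BlumeCapel.betaSeq α n, BlumeCapel.kSeq α l l' n) ∈ BlumeCapel.phaseCoexistence ∧
        0 < BlumeCapel.magnetization (BlumeCapel.betaSeq α n) (BlumeCapel.kSeq α l l' n) ∧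
        BlumeCapel.equilibriumSet (BlumeCapel.betaSeq α n) (BlumeCapel.kSeq α l l' n) =
          {BlumeCapel.magnetization (BlumeCapel.betaSeq α n) (BlumeCapel.kSeq α l l' n),
            -BlumeCapel.magnetization (BlumeCapel.betaSeq α n) (BlumeCapel.kSeq α l l' n)}) ∧
      Tendsto (fun n : ℕ =>
        BlumeCapel.magnetization (BlumeCapel.betaSeq α n) (BlumeCapel.kSeq α l l' n))
        atTop (𝓝 0) ∧
      Tendsto (fun n : ℕ => (n : ℝ) ^ (α / 2) *
        BlumeCapel.magnetization (BlumeCapel.betaSeq α n) (BlumeCapel.kSeq α l l' n))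
        atTop (𝓝 (BlumeCapel.xBar l)) ∧
      Asymptotics.IsEquivalent atTop
        (fun n : ℕ =>
          BlumeCapel.magnetization (BlumeCapel.betaSeq α n) (BlumeCapel.kSeq α l l' n))
        (fun n : ℕ => BlumeCapel.xBar l *
          (BlumeCapel.betaSeq α n - BlumeCapel.betaC) ^ (1 / 2 : ℝ))) := by
  have hε := tendsto_scaleSeq hα
  have hε0 : Tendsto (scaleSeq α) atTop (𝓝 0) := hε.mono_right nhdsWithin_le_nhds
  have hpos : ∀ᶠ n in atTop, 0 < scaleSeq α n := hε.eventually self_mem_nhdsWithin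
  have hβ : betaSeq α = fun n => betaC + scaleSeq α n ^ 2 := funext (betaSeq_eq α)
  have hK : kSeq α l l' = fun n => kAt l l' (scaleSeq α n ^ 2) := funext (kSeq_eq α l l')
  refine ⟨?_, ?_, ⟨ellC_eq_sub, ellC_eq_div, exists_ne_zero_mem_globalMinPoints_gl_iff l,
    fun h => ⟨xBar_pos l, globalMinPoints_gl_of_lt h⟩, ?_⟩, ?_⟩
  · rw [hβ, hK]
    refine Tendsto.prodMk_nhds ?_ ((tendsto_kAt l l').comp (tendsto_sq_nhdsGT_zero.comp hε))
    simpa using (hε0.pow 2).const_add betaC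
  · intro S hS u hu
    filter_upwards [hε.eventually (tendstoUniformlyOn_scaled_freeEnergy l l' hS u hu)] with n hn
    intro x hx
    have h6 : (n : ℝ) ^ (1 - (1 - 3 * α)) = (scaleSeq α n)⁻¹ ^ 6 := by
      rw [inv_pow, scaleSeq_pow, one_div, inv_inv]
      congr 1
      push_cast
      ring
    rw [h6, betaSeq_eq, kSeq_eq, div_eq_mul_one_div]
    exact hn x hx
  · rintro rfl
    exact ⟨xBar_ellC, globalMinPoints_gl_ellC⟩
  · intro hc
    -- The first three cases have ℓ > ℓ_c, the first two because ℓ_c = K''(β_c) - 5/(4β_c) lies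
    -- below K''(β_c). The last is the borderline case handled through K₁.
    obtain ⟨hl, hneg⟩ : ellC ≤ l ∧
        ∀ᶠ ε in 𝓝[>] (0 : ℝ), ∃ x, freeEnergy (betaC + ε ^ 2) (kAt l l' (ε ^ 2)) x < 0 := by
      have hlt : ellC < iteratedDeriv 2 curveK betaC := by
        have := betaC_pos
        rw [ellC_eq_sub]
        exact sub_lt_self _ (by positivity)
      have of_lt : ellC < l → ellC ≤ l ∧ ∀ᶠ ε in 𝓝[>] (0 : ℝ),
          ∃ x, freeEnergy (betaC + ε ^ 2) (kAt l l' (ε ^ 2)) x < 0 := fun h =>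
        ⟨h.le, eventually_freeEnergy_neg_of_lt h l'⟩
      rcases hc with h | ⟨h, -⟩ | ⟨-, h, -⟩ | ⟨rfl, h, h1, h2, h3⟩
      · exact of_lt (hlt.trans h)
      · exact of_lt (h ▸ hlt)
      · exact of_lt h
      · exact ⟨le_rfl, eventually_freeEnergy_neg_of_conjectures h1 h2 h3 h⟩
    have hdiv := (tendsto_magnetization_div hl hneg).comp hε
    have hscaled : Tendsto (fun n : ℕ => (n : ℝ) ^ (α / 2) *
        magnetization (betaSeq α n) (kSeq α l l' n)) atTop (𝓝 (xBar l)) := by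
      refine hdiv.congr fun n => ?_
      simp only [Function.comp, betaSeq_eq, kSeq_eq]
      rw [div_eq_mul_inv, mul_comm]
      congr 1
      rw [scaleSeq, one_div, inv_inv]
    refine ⟨?_, ?_, hscaled, ?_⟩
    · filter_upwards [hε.eventually hneg, hε.eventually (eventually_kAt_pos l l')]
        with n ⟨x, hx⟩ hk
      rw [betaSeq_eq, kSeq_eq]
      have hb := betaC_add_sq_pos (scaleSeq α n)
      obtain ⟨h1, -, h3⟩ := equilibriumSet_of_freeEnergy_neg hb hk hx
      refine ⟨⟨hb, hk, ?_⟩, h1, h3⟩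
      simp only [h3]
      exact nontrivial_pair (by linarith)
    · have := hdiv.mul hε0
      rw [mul_zero] at this
      refine this.congr' ?_
      filter_upwards [hpos] with n hn
      simp only [Function.comp, betaSeq_eq, kSeq_eq]
      exact div_mul_cancel₀ _ hn.ne'
    · apply Asymptotics.isEquivalent_of_tendsto_one
      have hx := xBar_pos l
      have := hdiv.div_const (xBar l)
      rw [div_self hx.ne'] at this
      refine this.congr' ?_
      filter_upwards [hpos] with n hn
      simp only [Function.comp, Pi.div_apply, betaSeq_eq, kSeq_eq, add_sub_cancel_left]
      rw [← Real.sqrt_eq_rpow, Real.sqrt_sq hn.le, div_div, mul_comm (scaleSeq α n)]
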